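/- Let $(W,S)$ be a Coxeter system with $S$ finite and length function $\ell$, let $\Gamma$ be a totally ordered abelian group, and let $\varphi\colon W\to\Gamma$ be a weight function, i.e. $\varphi(ww')=\varphi(w)+\varphi(w')$ whenever $\ell(ww')=\ell(w)+\ell(w')$. Let $A=\mathbb Z[\Gamma]=\bigoplus_{\gamma\in\Gamma}\mathbb Z e^{\gamma}$. Let $\mathcal H$ be the Hecke algebra of $(W,S,\Gamma,\varphi)$: the unital $A$-algebra generated by elements $T_w$ ($w\in W$) with $T_1=1$, $T_wT_{w'}=T_{ww'}$ if $\ell(ww')=\ell(w)+\ell(w')$, and $(T_s-e^{\varphi(s)})(T_s+e^{-\varphi(s)})=0$ for $s\in S$. Let $h\mapsto\overline h$ be the ring endomorphism of $\mathcal H$ with $\overline{e^\gamma}=e^{-\gamma}$ and $\overline{T_w}=T_{w^{-1}}^{-1}$. For $w\in W$ let $C_w\in\mathcal H$ be the Kazhdan–Lusztig element, determined by $\overline{C_w}=C_w$ and $C_w-T_w\in\bigoplus_{v\in W}A_{<0}T_v$, where $A_{<0}=\bigoplus_{\gamma<0}\mathbb Z e^\gamma$. Let $\tau\colon\mathcal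 H\to A$ be the $A$-linear map with $\tau(T_1)=1$ and $\tau(T_w)=0$ for $w\ne1$, and let $h_{x,y,z}\in A$ be the structure constants, zero for all but finitely many $z$, given by $C_xC_y=\sum_{z\in W}h_{x,y,z}C_z$. Let $p$ be a prime and let $G$ be a finite $p$-group of automorphisms of $W$ such that $\sigma(S)=S$ and $\varphi\circ\sigma=\varphi$ for all $\sigma\in G$. Let $W^G$ be the subgroup of fixed points of $G$ in $W$, let $S_G\subseteq W^G$ be the set of the longest elements of the subgroups $\langle\omega\rangle$, where $\omega$ runs over the $G$-orbits in $S$ such that $\langle\omega\rangle$ is finite, and let $\varphi_G$ be the restriction of $\varphi$ to $W^G$. Denote by $\mathcal H_G$, $T^G_w$, $C^G_w$, $\tau_G$, $h^G_{x,y,z}$ the objects defined as above from $(W^G,S_G,\Gamma,\varphi_G)$, with the length function of $W^G$ relative to $S_G$. Then all these objects are well defined for both data: the elements $T_w$ (resp. $T^G_w$) form an $A$-basis of $\mathcal H$ (resp. $\mathcal H_G$), and the bar map, $\tau$, the Kazhdan–Lusztig elements and the structure constants exist and are unique. Moreover, for all $x,y,z\in W^G$, $$h_{x,y,z}\equiv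 h^G_{x,y,z}\mod pA\qquad\text{and}\qquad \tau(C_z)\equiv\tau_G(C^G_z)\mod pA .$$ -/

import Mathlib

open scoped AddMonoidAlgebra

/-! Hecke algebras and Kazhdan-Lusztig bases attached to a group `W`, a set `S` of elements of `W`
and a function `φ : W → Γ` with values in a totally ordered abelian group. They are used for
`(W, S)` a Coxeter system and `φ` a weight function. -/

namespace KL

noncomputable section

section Length

variable {W : Type*} [Group W]

/-- The length function of `(W, S)`: the least number of factors in a product of elements of `S`
that is equal to `w`. -/
def wordLength (S : Set W) (w : W) : ℕ :=
  sInf {n : ℕ | ∃ l : List W, (∀ s ∈ l, s ∈ S) ∧ l.prod = w ∧ l.length = n}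

/-- For a Coxeter system, `wordLength` is the usual length function. -/
theorem wordLength_range_simple {B : Type*} {M : CoxeterMatrix B} (cs : CoxeterSystem M W)
    (w : W) : wordLength (Set.range cs.simple) w = cs.length w := by
  apply le_antisymm
  · obtain ⟨l, hl, rfl⟩ := cs.exists_isReduced w
    apply Nat.sInf_le
    refine ⟨l.map cs.simple, ?_, rfl, ?_⟩
    · intro s hs
      obtain ⟨i, -, rfl⟩ := List.mem_map.1 hs
      exact ⟨i, rfl⟩
    · simpa using hl.eq.symm
  · apply le_csInf
    · obtain ⟨l, rfl⟩ := cs.wordProd_surjective w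
      refine ⟨_, l.map cs.simple, ?_, rfl, rfl⟩
      intro s hs
      obtain ⟨i, -, rfl⟩ := List.mem_map.1 hs
      exact ⟨i, rfl⟩
    · rintro n ⟨l, hl, rfl, rfl⟩
      obtain ⟨l', rfl⟩ : ∃ l' : List B, l'.map cs.simple = l := by
        have : l ∈ Set.range (List.map cs.simple) := by
          rw [Set.range_list_map]
          exact hl
        exact this
      simpa [CoxeterSystem.wordProd] using cs.length_wordProd_le l'

/-- Weight functions: `φ (w w') = φ w + φ w'` whenever `ℓ (w w') = ℓ w + ℓ w'`. -/
def IsWeightFunction {Γ : Type*} [Add Γ] (S : Set W) (φ : W → Γ) : Prop :=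
  ∀ w w' : W, wordLength S (w * w') = wordLength S w + wordLength S w' →
    φ (w * w') = φ w + φ w'

/-- `w` is a longest element of the standard parabolic subgroup generated by `I ⊆ S`. -/
def IsLongest (S I : Set W) (w : W) : Prop :=
  w ∈ Subgroup.closure I ∧ ∀ v ∈ Subgroup.closure I, wordLength S v ≤ wordLength S w

/-- The set `S_G` of the longest elements `s_ω` of the subgroups `W_ω = ⟨ω⟩`, where `ω` runs over
the `G`-orbits in `S` such that `W_ω` is finite, as a subset of the group `W ^ G` of fixed
points. -/
def fixedSimple (S : Set W) (G : Subgroup (MulAut W)) : Set (FixedPoints.subgroup G W) :=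
  {x | ∃ s ∈ S, (Subgroup.closure (MulAction.orbit G s) : Set W).Finite ∧
    IsLongest S (MulAction.orbit G s) (x : W)}

/-- The restriction `φ_G` of `φ` to `W ^ G`. -/
def fixedWeight {Γ : Type*} (φ : W → Γ) (G : Subgroup (MulAut W)) :
    FixedPoints.subgroup G W → Γ :=
  fun w => φ (w : W)

end Length

section Hecke

variable {W : Type*} [Group W] {Γ : Type*} [AddCommGroup Γ]

/-- The element `e ^ γ` of the group algebra `A = ℤ[Γ]`. -/
def expo (γ : Γ) : ℤ[Γ] := AddMonoidAlgebra.single γ 1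

/-- The defining relations of the Hecke algebra between the generators `T_w`, `w ∈ W`. -/
inductive HeckeRel (S : Set W) (φ : W → Γ) : FreeAlgebra ℤ[Γ] W → FreeAlgebra ℤ[Γ] W → Prop
  | one : HeckeRel S φ (FreeAlgebra.ι ℤ[Γ] 1) 1
  | mul (w w' : W) (h : wordLength S (w * w') = wordLength S w + wordLength S w') :
      HeckeRel S φ (FreeAlgebra.ι ℤ[Γ] w * FreeAlgebra.ι ℤ[Γ] w') (FreeAlgebra.ι ℤ[Γ] (w * w'))
  | quadratic (s : W) (hs : s ∈ S) :
      HeckeRel S φ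
        ((FreeAlgebra.ι ℤ[Γ] s - algebraMap ℤ[Γ] _ (expo (φ s))) *
          (FreeAlgebra.ι ℤ[Γ] s + algebraMap ℤ[Γ] _ (expo (-φ s)))) 0

/-- The Hecke algebra of `(W, S, Γ, φ)`, an algebra over `A = ℤ[Γ]`. -/
def Hecke (S : Set W) (φ : W → Γ) : Type _ := RingQuot (HeckeRel S φ)

instance (S : Set W) (φ : W → Γ) : Ring (Hecke S φ) :=
  inferInstanceAs (Ring (RingQuot (HeckeRel S φ)))

instance (S : Set W) (φ : W → Γ) : Algebra ℤ[Γ] (Hecke S φ) :=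
  inferInstanceAs (Algebra ℤ[Γ] (RingQuot (HeckeRel S φ)))

/-- The canonical map from the free algebra to the Hecke algebra. -/
def mk (S : Set W) (φ : W → Γ) : FreeAlgebra ℤ[Γ] W →ₐ[ℤ[Γ]] Hecke S φ :=
  RingQuot.mkAlgHom ℤ[Γ] (HeckeRel S φ)

/-- The standard basis element `T_w`. -/
def T (S : Set W) (φ : W → Γ) (w : W) : Hecke S φ :=
  mk S φ (FreeAlgebra.ι ℤ[Γ] w)

/-- `β` is the bar involution: `β (e ^ γ) = e ^ (-γ)`, and `β (T_w)` is the inverse of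
`T_{w⁻¹}`. -/
def IsBar (S : Set W) (φ : W → Γ) (β : Hecke S φ →+* Hecke S φ) : Prop :=
  (∀ γ : Γ, β (algebraMap ℤ[Γ] _ (expo γ)) = algebraMap ℤ[Γ] _ (expo (-γ))) ∧
    ∀ w : W, β (T S φ w) * T S φ w⁻¹ = 1 ∧ T S φ w⁻¹ * β (T S φ w) = 1

/-- The bar involution of the Hecke algebra. -/
def bar (S : Set W) (φ : W → Γ) : Hecke S φ →+* Hecke S φ :=
  @Classical.epsilon _ ⟨RingHom.id _⟩ (IsBar S φ)

/-- The subgroup `⊕_w A_{<0} T_w`, where `A_{<0} = ⊕_{γ < 0} ℤ e ^ γ`. -/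
def negPart [LinearOrder Γ] (S : Set W) (φ : W → Γ) : AddSubgroup (Hecke S φ) :=
  AddSubgroup.closure {h | ∃ γ : Γ, γ < 0 ∧ ∃ w : W, h = expo γ • T S φ w}

/-- The defining property of the Kazhdan-Lusztig element `C_w`. -/
def IsKLElement [LinearOrder Γ] (S : Set W) (φ : W → Γ) (w : W) (c : Hecke S φ) : Prop :=
  bar S φ c = c ∧ c - T S φ w ∈ negPart S φ

/-- The Kazhdan-Lusztig basis `(C_w)`. -/
def C [LinearOrder Γ] (S : Set W) (φ : W → Γ) (w : W) : Hecke S φ :=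
  @Classical.epsilon _ ⟨0⟩ (IsKLElement S φ w)

open Classical in
/-- `t` is the `A`-linear form with `t (T_1) = 1` and `t (T_w) = 0` for `w ≠ 1`. -/
def IsTau (S : Set W) (φ : W → Γ) (t : Hecke S φ →ₗ[ℤ[Γ]] ℤ[Γ]) : Prop :=
  ∀ w : W, t (T S φ w) = if w = 1 then 1 else 0

/-- The linear form `τ`. -/
def tau (S : Set W) (φ : W → Γ) : Hecke S φ →ₗ[ℤ[Γ]] ℤ[Γ] :=
  @Classical.epsilon _ ⟨0⟩ (IsTau S φ)

/-- `f` is the (finitely supported) family of coordinates of `C_x C_y` in the Kazhdan-Lusztig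
basis. -/
def IsStructureFamily [LinearOrder Γ] (S : Set W) (φ : W → Γ) (x y : W) (f : W →₀ ℤ[Γ]) : Prop :=
  C S φ x * C S φ y = f.sum fun z a => a • C S φ z

/-- The structure constants `h_{x,y,z}`, with `C_x C_y = ∑_z h_{x,y,z} C_z`. -/
def structureConst [LinearOrder Γ] (S : Set W) (φ : W → Γ) (x y z : W) : ℤ[Γ] :=
  @Classical.epsilon _ ⟨0⟩ (IsStructureFamily S φ x y) z

/-- All the objects above are well defined: `(T_w)` is an `A`-basis of the Hecke algebra, and the
bar involution, the linear form `τ`, the elements `C_w` and the constants `h_{x,y,z}` exist and are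
determined uniquely by their defining properties. -/
structure WellDefined [LinearOrder Γ] (S : Set W) (φ : W → Γ) : Prop where
  linearIndependent_T : LinearIndependent ℤ[Γ] (T S φ)
  span_T : Submodule.span ℤ[Γ] (Set.range (T S φ)) = ⊤
  bar : ∃! β, IsBar S φ β
  tau : ∃! t, IsTau S φ t
  C : ∀ w, ∃! c, IsKLElement S φ w c
  structureConst : ∀ x y, ∃! f, IsStructureFamily S φ x y f

end Hecke

end

end KL

/-!
Let `H` and `Hᴳ` be the two Hecke algebras, and let `π : H → Hᴳ` keep the coefficients on the `T_w`
with `w ∈ W ^ G`. Everything rests on one congruence: a `G`-invariant sum over `W` is, modulo `p`,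
the sum over `W ^ G`, since every other orbit of the `p`-group `G` has size divisible by `p`.

The main point is that, modulo `p`, `π` is multiplicative on `G`-invariant elements. The defect
`π(xy) - π(x)π(y)` satisfies the 2-cocycle identity, so that an induction on the length in `W ^ G`
reduces the claim to `T_x T_x` with `x ∈ S_G`. There `x` is the longest element of a finite
parabolic subgroup whose only `G`-fixed elements are `1` and `x`, so `π(T_x ^ 2) = 1 + a T_x`, and
comparing the values of the index characters `T_w ↦ e ^ φ(w)` on both sides gives
`a ≡ e ^ φ(x) - e ^ (-φ(x))`.

Being multiplicative, `π` commutes with the bar involutions modulo `p` on invariant elements. Hence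
`π(C_z) - C^G_z` is bar invariant modulo `p` with coefficients in `A_{<0}`, which forces it to be
divisible by `p`. Both congruences are then read off in `Hᴳ`.

That `W ^ G` is itself a Coxeter group comes from the description of Coxeter systems by the
half-spaces `{w | ℓ(w) < ℓ(sw)}`: for `x ∈ S_G`, the set `{w | ℓ(w) < ℓ(xw)}` defined with the
length of `W` has the properties characterizing the half-space of `x` in `W ^ G`.
-/

namespace KL

local notation "ℓ[" S "]" => wordLength S

section WordLength

variable {W : Type*} [Group W] {S : Set W}

theorem wordLength_prod_le {l : List W} (hl : ∀ s ∈ l, s ∈ S) : ℓ[S] l.prod ≤ l.length :=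
  Nat.sInf_le ⟨l, hl, rfl, rfl⟩

theorem wordLength_one : ℓ[S] (1 : W) = 0 := by
  simpa using wordLength_prod_le (S := S) (l := []) (by simp)

theorem wordLength_le_one {s : W} (hs : s ∈ S) : ℓ[S] s ≤ 1 := by
  simpa using wordLength_prod_le (S := S) (l := [s]) (by simpa using hs)

theorem IsWeightFunction.map_one {Γ : Type*} [AddCommGroup Γ] {φ : W → Γ}
    (hφ : IsWeightFunction S φ) : φ 1 = 0 := by
  simpa [wordLength_one] using hφ 1 1

/-- The elements of `S` are of order at most two and generate the group. -/
structure GeneratedByInvolutions (S : Set W) : Prop where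
  mul_self : ∀ s ∈ S, s * s = 1
  closure_eq_top : Subgroup.closure S = ⊤

/-- `(W, S)` is a Coxeter system, in the form of Tits' criterion: `S` consists of generating
involutions that satisfy the folding condition. No Coxeter matrix occurs, so that the notion can
be verified directly for the group of fixed points of automorphisms. -/
structure IsCoxeter (S : Set W) : Prop extends GeneratedByInvolutions S where
  wordLength_simple_mul_ne : ∀ s ∈ S, ∀ w, ℓ[S] (s * w) ≠ ℓ[S] w
  fold : ∀ s ∈ S, ∀ t ∈ S, ∀ w, ℓ[S] w < ℓ[S] (s * w) → ℓ[S] (s * (w * t)) < ℓ[S] (w * t) →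
    s * w = w * t

namespace GeneratedByInvolutions

theorem inv_eq (hS : GeneratedByInvolutions S) {s : W} (hs : s ∈ S) : s⁻¹ = s :=
  inv_eq_of_mul_eq_one_right (hS.mul_self s hs)

theorem simple_mul_cancel_left (hS : GeneratedByInvolutions S) {s : W} (hs : s ∈ S) (w : W) :
    s * (s * w) = w := by
  rw [← mul_assoc, hS.mul_self s hs, one_mul]

theorem simple_mul_cancel_right (hS : GeneratedByInvolutions S) {s : W} (hs : s ∈ S) (w : W) :
    w * s * s = w := by
  rw [mul_assoc, hS.mul_self s hs, mul_one]

theorem exists_reduced_word (hS : GeneratedByInvolutions S) (w : W) :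
    ∃ l : List W, (∀ s ∈ l, s ∈ S) ∧ l.prod = w ∧ l.length = ℓ[S] w := by
  have words_nonempty :
      {n : ℕ | ∃ l : List W, (∀ s ∈ l, s ∈ S) ∧ l.prod = w ∧ l.length = n}.Nonempty := by
    have hw : w ∈ Subgroup.closure S := hS.closure_eq_top ▸ Subgroup.mem_top w
    rw [← Subgroup.mem_toSubmonoid, Subgroup.closure_toSubmonoid] at hw
    obtain ⟨l, hl, hprod⟩ := Submonoid.exists_list_of_mem_closure hw
    refine ⟨l.length, l, fun s hs => ?_, hprod, rfl⟩
    rcases hl s hs with hs | hs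
    · exact hs
    · rwa [← inv_inv s, hS.inv_eq hs]
  exact Nat.sInf_mem words_nonempty

theorem wordLength_mul_le (hS : GeneratedByInvolutions S) (x y : W) :
    ℓ[S] (x * y) ≤ ℓ[S] x + ℓ[S] y := by
  obtain ⟨l, hl, rfl, hlx⟩ := hS.exists_reduced_word x
  obtain ⟨m, hm, rfl, hmy⟩ := hS.exists_reduced_word y
  rw [← hlx, ← hmy, ← List.prod_append, ← List.length_append]
  exact wordLength_prod_le fun s hs => (List.mem_append.1 hs).elim (hl s) (hm s)

theorem wordLength_inv_le (hS : GeneratedByInvolutions S) (x : W) : ℓ[S] x⁻¹ ≤ ℓ[S] x := by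
  obtain ⟨l, hl, rfl, hlx⟩ := hS.exists_reduced_word x
  rw [← hlx, List.prod_inv_reverse, ← List.length_map (as := l) (·⁻¹), ← List.length_reverse]
  refine wordLength_prod_le fun s hs => ?_
  obtain ⟨t, ht, rfl⟩ := List.mem_map.1 (List.mem_reverse.1 hs)
  exact (hS.inv_eq (hl t ht)).symm ▸ hl t ht

theorem wordLength_inv (hS : GeneratedByInvolutions S) (x : W) : ℓ[S] x⁻¹ = ℓ[S] x :=
  le_antisymm (hS.wordLength_inv_le x) (by simpa using hS.wordLength_inv_le x⁻¹)

theorem eq_one_of_wordLength_eq_zero (hS : GeneratedByInvolutions S) {x : W}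
    (hx : ℓ[S] x = 0) : x = 1 := by
  obtain ⟨l, -, rfl, hl⟩ := hS.exists_reduced_word x
  rw [hx, List.length_eq_zero_iff] at hl
  simp [hl]

/-- Following a word that leaves the half-space `H` of `s`, the letter at which this happens can
be omitted. -/
theorem exists_sublist_of_halfSpace (hS : GeneratedByInvolutions S) {s : W} {H : W → Prop}
    (fold : ∀ t ∈ S, ∀ w, H w → ¬ H (w * t) → s * w = w * t) {l : List W}
    (hl : ∀ t ∈ l, t ∈ S) {x : W} (hx : H x) (hxl : ¬ H (x * l.prod)) :
    ∃ l' : List W, l'.Sublist l ∧ l'.length + 1 = l.length ∧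
      s * (x * l.prod) = x * l'.prod := by
  induction l generalizing x with
  | nil => simp [hx] at hxl
  | cons t l ih =>
    by_cases hxt : H (x * t)
    · obtain ⟨l', hsub, hlen, hprod⟩ := ih (fun u hu => hl u (List.mem_cons_of_mem t hu)) hxt
        (by simpa [mul_assoc] using hxl)
      exact ⟨t :: l', by simpa using hsub, by simpa using hlen, by simpa [mul_assoc] using hprod⟩
    · have ht : t ∈ S := hl t List.mem_cons_self
      refine ⟨l, by simp, by simp, ?_⟩
      rw [List.prod_cons, ← mul_assoc, fold t ht x hx hxt, mul_assoc,
        hS.simple_mul_cancel_left ht]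

theorem wordLength_simple_mul_lt_of_halfSpace (hS : GeneratedByInvolutions S) {s : W}
    {H : W → Prop} (one : H 1) (fold : ∀ t ∈ S, ∀ w, H w → ¬ H (w * t) → s * w = w * t)
    {w : W} (hw : ¬ H w) : ℓ[S] (s * w) < ℓ[S] w := by
  obtain ⟨l, hl, rfl, hlw⟩ := hS.exists_reduced_word w
  obtain ⟨l', hsub, hlen, hprod⟩ :=
    hS.exists_sublist_of_halfSpace fold hl one (by simpa using hw)
  rw [one_mul, one_mul] at hprod
  rw [hprod, ← hlw, ← hlen, Nat.lt_succ_iff]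
  exact wordLength_prod_le fun t ht => hl t (hsub.subset ht)

theorem lt_wordLength_simple_mul_iff_of_halfSpace (hS : GeneratedByInvolutions S) {s : W}
    (hs : s ∈ S) {H : W → Prop} (one : H 1) (not_simple_mul : ∀ w, H w → ¬ H (s * w))
    (fold : ∀ t ∈ S, ∀ w, H w → ¬ H (w * t) → s * w = w * t) {w : W} :
    ℓ[S] w < ℓ[S] (s * w) ↔ H w := by
  refine ⟨fun hlt => ?_, fun hw => ?_⟩
  · by_contra hw
    exact hlt.not_gt (hS.wordLength_simple_mul_lt_of_halfSpace one fold hw)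
  · simpa [hS.simple_mul_cancel_left hs] using
      hS.wordLength_simple_mul_lt_of_halfSpace one fold (not_simple_mul w hw)

end GeneratedByInvolutions

theorem IsCoxeter.of_halfSpaces (hS : GeneratedByInvolutions S) (H : W → W → Prop)
    (one : ∀ s ∈ S, H s 1) (not_simple_mul : ∀ s ∈ S, ∀ w, H s w → ¬ H s (s * w))
    (fold : ∀ s ∈ S, ∀ t ∈ S, ∀ w, H s w → ¬ H s (w * t) → s * w = w * t) : IsCoxeter S := by
  have lt_iff {s w : W} (hs : s ∈ S) : ℓ[S] w < ℓ[S] (s * w) ↔ H s w :=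
    hS.lt_wordLength_simple_mul_iff_of_halfSpace hs (one s hs) (not_simple_mul s hs) (fold s hs)
  refine { hS with
    wordLength_simple_mul_ne := fun s hs w => ?_
    fold := fun s hs t ht w hw hwt =>
      fold s hs t ht w ((lt_iff hs).1 hw) (mt (lt_iff hs).2 hwt.not_gt) }
  by_cases hw : H s w
  · exact ((lt_iff hs).2 hw).ne'
  · exact (hS.wordLength_simple_mul_lt_of_halfSpace (one s hs) (fold s hs) hw).ne

namespace IsCoxeter

theorem wordLength_simple_mul (hS : IsCoxeter S) {s : W} (hs : s ∈ S) (w : W) :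
    ℓ[S] (s * w) = ℓ[S] w + 1 ∨ ℓ[S] (s * w) + 1 = ℓ[S] w := by
  have upper := hS.wordLength_mul_le s w
  have lower := hS.wordLength_mul_le s (s * w)
  rw [hS.simple_mul_cancel_left hs] at lower
  have := wordLength_le_one hs
  have := hS.wordLength_simple_mul_ne s hs w
  lia

theorem wordLength_mul_simple (hS : IsCoxeter S) {s : W} (hs : s ∈ S) (w : W) :
    ℓ[S] (w * s) = ℓ[S] w + 1 ∨ ℓ[S] (w * s) + 1 = ℓ[S] w := by
  rw [← hS.wordLength_inv (w * s), ← hS.wordLength_inv w, mul_inv_rev, hS.inv_eq hs]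
  exact hS.wordLength_simple_mul hs _

theorem wordLength_simple (hS : IsCoxeter S) {s : W} (hs : s ∈ S) : ℓ[S] s = 1 := by
  have := hS.wordLength_simple_mul hs 1
  rw [mul_one, wordLength_one] at this
  lia

theorem exchange (hS : IsCoxeter S) {s : W} (hs : s ∈ S) {x : W} {l : List W}
    (hl : ∀ t ∈ l, t ∈ S) (hx : ℓ[S] x < ℓ[S] (s * x))
    (hxl : ℓ[S] (s * (x * l.prod)) < ℓ[S] (x * l.prod)) :
    ∃ l' : List W, l'.Sublist l ∧ l'.length + 1 = l.length ∧
      s * (x * l.prod) = x * l'.prod := by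
  refine hS.exists_sublist_of_halfSpace (H := fun w => ℓ[S] w < ℓ[S] (s * w))
    (fun t ht w hw hwt => ?_) hl hx hxl.not_gt
  exact hS.fold s hs t ht w hw
    ((hS.wordLength_simple_mul_ne s hs (w * t)).lt_of_le (not_lt.1 hwt))

theorem exchange_right_factor (hS : IsCoxeter S) {s : W} (hs : s ∈ S) {x y : W}
    (hx : ℓ[S] x < ℓ[S] (s * x)) (hxy : ℓ[S] (s * (x * y)) < ℓ[S] (x * y)) :
    ∃ y', ℓ[S] y' < ℓ[S] y ∧ s * (x * y) = x * y' := by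
  obtain ⟨l, hl, rfl, hly⟩ := hS.exists_reduced_word y
  obtain ⟨l', hsub, hlen, hprod⟩ := hS.exchange hs hl hx hxy
  refine ⟨l'.prod, ?_, hprod⟩
  have := wordLength_prod_le (S := S) fun t ht => hl t (hsub.subset ht)
  lia

theorem wordLength_simple_mul_mul_lt_iff (hS : IsCoxeter S) {s t : W} (hs : s ∈ S)
    (ht : t ∈ S) {w : W} (hne : s * w ≠ w * t) :
    ℓ[S] (s * (w * t)) < ℓ[S] (w * t) ↔ ℓ[S] (s * w) < ℓ[S] w := by
  have hne_w := hS.wordLength_simple_mul_ne s hs w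
  have hne_wt := hS.wordLength_simple_mul_ne s hs (w * t)
  constructor
  · intro hlt
    by_contra hnot
    exact hne (hS.fold s hs t ht w (by lia) hlt)
  · intro hlt
    by_contra hnot
    have hfold := hS.fold s hs t ht (w * t) (by lia) (by rwa [hS.simple_mul_cancel_right ht])
    rw [hS.simple_mul_cancel_right ht] at hfold
    exact hne (by rw [← hfold, hS.simple_mul_cancel_left hs, hfold])

theorem weight_eq_of_simple_mul_eq_mul_simple (hS : IsCoxeter S) {Γ : Type*} [AddCommGroup Γ]
    {φ : W → Γ} (hφ : IsWeightFunction S φ) {s t w : W} (hs : s ∈ S) (ht : t ∈ S)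
    (hw : s * w = w * t) : φ s = φ t := by
  wlog hlt : ℓ[S] (s * w) = ℓ[S] w + 1 generalizing w
  · have hcancel := hS.simple_mul_cancel_left hs w
    refine this (w := s * w) (by rw [hcancel, hw, hS.simple_mul_cancel_right ht]) ?_
    have := hS.wordLength_simple_mul hs w
    rw [hcancel]
    lia
  have hs_len := hS.wordLength_simple hs
  have ht_len := hS.wordLength_simple ht
  have hsw : φ (s * w) = φ s + φ w := hφ s w (by lia)
  have hwt : φ (w * t) = φ w + φ t := hφ w t (by rw [← hw]; lia)
  rw [← hw, hsw, add_comm] at hwt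
  exact add_left_cancel hwt

section Parabolic

variable {I : Set W}

theorem exists_reduced_word_of_mem_closure (hS : IsCoxeter S) (hI : I ⊆ S) {c : W}
    (hc : c ∈ Subgroup.closure I) :
    ∃ l : List W, (∀ s ∈ l, s ∈ I) ∧ l.prod = c ∧ l.length = ℓ[S] c := by
  have simple_mul : ∀ s ∈ I, ∀ c,
      (∃ l : List W, (∀ t ∈ l, t ∈ I) ∧ l.prod = c ∧ l.length = ℓ[S] c) →
      ∃ l : List W, (∀ t ∈ l, t ∈ I) ∧ l.prod = s * c ∧ l.length = ℓ[S] (s * c) := by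
    rintro s hs c ⟨l, hl, rfl, hlen⟩
    rcases hS.wordLength_simple_mul (hI hs) l.prod with hup | hdown
    · exact ⟨s :: l, List.forall_mem_cons.2 ⟨hs, hl⟩, by simp, by simp [hup, hlen]⟩
    · obtain ⟨l', hsub, hlen', hprod⟩ := hS.exchange (hI hs) (x := 1) (fun t ht => hI (hl t ht))
        (by simp [wordLength_one, hS.wordLength_simple (hI hs)]) (by simp only [one_mul]; lia)
      rw [one_mul, one_mul] at hprod
      exact ⟨l', fun t ht => hl t (hsub.subset ht), hprod.symm, by lia⟩
  induction hc using Subgroup.closure_induction_left with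
  | one => exact ⟨[], by simp, by simp, by simp [wordLength_one]⟩
  | mul_left s hs c _ ih => exact simple_mul s hs c ih
  | inv_mul_cancel s hs c _ ih =>
    rw [hS.inv_eq (hI hs)]
    exact simple_mul s hs c ih

theorem closure_induction (hS : IsCoxeter S) (hI : I ⊆ S) {p : W → Prop} (one : p 1)
    (simple_mul : ∀ s ∈ I, ∀ c ∈ Subgroup.closure I, ℓ[S] (s * c) = ℓ[S] c + 1 →
      p c → p (s * c)) {c : W} (hc : c ∈ Subgroup.closure I) : p c := by
  obtain ⟨l, hl, rfl, hlen⟩ := hS.exists_reduced_word_of_mem_closure hI hc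
  clear hc
  induction l with
  | nil => exact one
  | cons s l ih =>
    obtain ⟨hs, hl⟩ := List.forall_mem_cons.1 hl
    have hle := wordLength_prod_le (S := S) fun t ht => hI (hl t ht)
    have hstep := hS.wordLength_simple_mul (hI hs) l.prod
    rw [List.prod_cons, List.length_cons] at hlen
    rw [List.prod_cons]
    exact simple_mul s hs _
      (Subgroup.list_prod_mem _ fun t ht => Subgroup.subset_closure (hl t ht)) (by lia)
      (ih hl (by lia))

theorem induction_left (hS : IsCoxeter S) {p : W → Prop} (one : p 1)
    (simple_mul : ∀ s ∈ S, ∀ c, ℓ[S] (s * c) = ℓ[S] c + 1 → p c → p (s * c)) (w : W) : p w :=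
  hS.closure_induction subset_rfl one (fun s hs c _ => simple_mul s hs c)
    (hS.closure_eq_top ▸ Subgroup.mem_top w)

theorem induction_right (hS : IsCoxeter S) {p : W → Prop} (one : p 1)
    (mul_simple : ∀ s ∈ S, ∀ c, ℓ[S] (c * s) = ℓ[S] c + 1 → p c → p (c * s)) (w : W) :
    p w := by
  rw [← inv_inv w]
  refine hS.induction_left (p := fun w => p w⁻¹) (by simpa using one)
    (fun s hs c hlen hc => ?_) w⁻¹
  rw [mul_inv_rev, hS.inv_eq hs]
  refine mul_simple s hs _ ?_ hc
  rw [← hS.wordLength_inv, mul_inv_rev, inv_inv, hS.inv_eq hs, hlen, hS.wordLength_inv]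

theorem exists_descent (hS : IsCoxeter S) (hI : I ⊆ S) {c : W}
    (hc : c ∈ Subgroup.closure I) (hne : c ≠ 1) : ∃ s ∈ I, ℓ[S] (s * c) < ℓ[S] c := by
  refine (hS.closure_induction hI (p := fun c => c = 1 ∨ ∃ s ∈ I, ℓ[S] (s * c) < ℓ[S] c)
    (Or.inl rfl) (fun s hs c _ hlen _ => Or.inr ⟨s, hs, ?_⟩) hc).resolve_left hne
  rw [hS.simple_mul_cancel_left (hI hs)]
  lia

theorem exists_reduced_factorization_of_descents (hS : IsCoxeter S) (hI : I ⊆ S) {w : W}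
    (hw : ∀ s ∈ I, ℓ[S] (s * w) < ℓ[S] w) {c : W} (hc : c ∈ Subgroup.closure I) :
    ∃ d, w = c * d ∧ ℓ[S] w = ℓ[S] c + ℓ[S] d := by
  refine hS.closure_induction hI (p := fun c => ∃ d, w = c * d ∧ ℓ[S] w = ℓ[S] c + ℓ[S] d)
    ⟨w, by simp, by simp [wordLength_one]⟩ ?_ hc
  rintro s hs c - hlen ⟨d, hcd, hadd⟩
  have hdescent := hw s hs
  rw [hcd] at hdescent
  obtain ⟨y, hyd, hy⟩ := hS.exchange_right_factor (hI hs) (by lia) hdescent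
  have hwy : w = s * c * y := by
    rw [mul_assoc, ← hy, ← hcd, hS.simple_mul_cancel_left (hI hs)]
  have hle := hS.wordLength_mul_le (s * c) y
  exact ⟨y, hwy, le_antisymm (hwy ▸ hle) (by lia)⟩

theorem wordLength_mul_of_minimal (hS : IsCoxeter S) (hI : I ⊆ S) {v : W}
    (hv : ∀ c ∈ Subgroup.closure I, ℓ[S] v ≤ ℓ[S] (c * v)) {c : W}
    (hc : c ∈ Subgroup.closure I) : ℓ[S] (c * v) = ℓ[S] c + ℓ[S] v := by
  refine hS.closure_induction hI (p := fun c => ℓ[S] (c * v) = ℓ[S] c + ℓ[S] v)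
    (by simp [wordLength_one]) (fun s hs c hc hlen ih => ?_) hc
  rcases hS.wordLength_simple_mul (hI hs) (c * v) with hup | hdown
  · rw [mul_assoc, hup, ih, hlen, add_right_comm]
  · obtain ⟨y, hyv, hy⟩ := hS.exchange_right_factor (hI hs) (x := c) (y := v) (by lia) (by lia)
    have hmem : c⁻¹ * s * c ∈ Subgroup.closure I :=
      mul_mem (mul_mem (inv_mem hc) (Subgroup.subset_closure hs)) hc
    have hy' : c⁻¹ * s * c * v = y := by
      rw [mul_assoc, mul_assoc, hy, inv_mul_cancel_left]
    exact absurd (hv _ hmem) (by rw [hy']; exact hyv.not_ge)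

theorem wordLength_mul_of_ascents (hS : IsCoxeter S) (hI : I ⊆ S) {w : W}
    (hw : ∀ s ∈ I, ℓ[S] w < ℓ[S] (s * w)) {c : W} (hc : c ∈ Subgroup.closure I) :
    ℓ[S] (c * w) = ℓ[S] c + ℓ[S] w := by
  obtain ⟨c₀, hc₀, hmin⟩ : ∃ c₀ ∈ Subgroup.closure I, ∀ c ∈ Subgroup.closure I,
      ℓ[S] (c₀ * w) ≤ ℓ[S] (c * w) :=
    ⟨_, Function.argminOn_mem (fun c => ℓ[S] (c * w)) (Subgroup.closure I : Set W)
      ⟨1, one_mem _⟩, fun c hc => Function.argminOn_le (fun c => ℓ[S] (c * w)) _ hc⟩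
  have additive : ∀ c ∈ Subgroup.closure I,
      ℓ[S] (c * (c₀ * w)) = ℓ[S] c + ℓ[S] (c₀ * w) := fun c =>
    hS.wordLength_mul_of_minimal hI fun c hc => by
      rw [← mul_assoc]
      exact hmin _ (mul_mem hc hc₀)
  have hc₀_eq : c₀⁻¹ = 1 := by
    by_contra hne
    obtain ⟨s, hs, hdescent⟩ := hS.exists_descent hI (inv_mem hc₀) hne
    have hlen_w := additive _ (inv_mem hc₀)
    have hlen_sw := additive _ (mul_mem (Subgroup.subset_closure hs) (inv_mem hc₀))
    rw [mul_assoc, inv_mul_cancel_left] at hlen_sw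
    rw [inv_mul_cancel_left] at hlen_w
    have := hw s hs
    lia
  simpa [inv_eq_one.1 hc₀_eq] using additive c hc

theorem finite_closure_of_descents (hS : IsCoxeter S) (hI : I ⊆ S) (hfin : I.Finite) {w : W}
    (hw : ∀ s ∈ I, ℓ[S] (s * w) < ℓ[S] w) : (Subgroup.closure I : Set W).Finite := by
  have : Finite I := hfin
  refine ((List.finite_length_le I (ℓ[S] w)).image
    fun l => (l.map Subtype.val).prod).subset fun c hc => ?_
  obtain ⟨l, hl, hprod, hlen⟩ := hS.exists_reduced_word_of_mem_closure hI hc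
  obtain ⟨d, -, hadd⟩ := hS.exists_reduced_factorization_of_descents hI hw hc
  exact ⟨l.attach.map fun x => ⟨x.1, hl x.1 x.2⟩, by simp; lia, by simp [hprod, Function.comp_def]⟩

theorem descent_of_isLongest (hS : IsCoxeter S) (hI : I ⊆ S) {w : W} (hw : IsLongest S I w)
    {s : W} (hs : s ∈ I) : ℓ[S] (s * w) < ℓ[S] w := by
  have := hw.2 _ (mul_mem (Subgroup.subset_closure hs) hw.1)
  have := hS.wordLength_simple_mul (hI hs) w
  lia

theorem eq_of_isLongest_of_descents (hS : IsCoxeter S) (hI : I ⊆ S) {w w' : W}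
    (hw : IsLongest S I w) (hw' : w' ∈ Subgroup.closure I)
    (hdescents : ∀ s ∈ I, ℓ[S] (s * w') < ℓ[S] w') : w' = w := by
  obtain ⟨d, hwd, hadd⟩ := hS.exists_reduced_factorization_of_descents hI hdescents hw.1
  have := hw.2 _ hw'
  rw [hwd, hS.eq_one_of_wordLength_eq_zero (x := d) (by lia), mul_one]

theorem mul_self_of_isLongest (hS : IsCoxeter S) (hI : I ⊆ S) {w : W}
    (hw : IsLongest S I w) : w * w = 1 := by
  have hinv : IsLongest S I w⁻¹ :=
    ⟨inv_mem hw.1, fun v hv => (hS.wordLength_inv w).symm ▸ hw.2 v hv⟩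
  have heq : w⁻¹ = w :=
    hS.eq_of_isLongest_of_descents hI hw hinv.1 fun s hs => hS.descent_of_isLongest hI hinv hs
  rw [← inv_eq_iff_mul_eq_one, heq]

end Parabolic

end IsCoxeter

theorem exists_isLongest_of_finite_closure {I : Set W}
    (hfin : (Subgroup.closure I : Set W).Finite) : ∃ w, IsLongest S I w :=
  Set.exists_max_image _ (wordLength S) hfin ⟨1, one_mem _⟩

end WordLength

noncomputable section CoxeterSystem

open CoxeterSystem

open scoped Classical in
/-- The permutation of `W × ℤ/2` that conjugates the first component by the simple reflection `s i`
and changes the second one when the first one is `s i`. Under the resulting action of `W` (the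
signed permutation action on reflections) the second component counts inversions modulo two. -/
def signedReflection {B W : Type*} [Group W] {M : CoxeterMatrix B} (cs : CoxeterSystem M W)
    (i : B) : Function.End (W × ZMod 2) :=
  fun x => (cs.simple i * x.1 * cs.simple i, x.2 + if x.1 = cs.simple i then 1 else 0)

variable {B W : Type*} [Group W] {M : CoxeterMatrix B} (cs : CoxeterSystem M W)

open scoped Classical in
theorem prod_map_signedReflection (ω : List B) (x : W × ZMod 2) :
    (ω.reverse.map (signedReflection cs)).prod x =
      ((cs.wordProd ω)⁻¹ * x.1 * cs.wordProd ω, x.2 + (cs.leftInvSeq ω).count x.1) := by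
  induction ω using List.reverseRecOn with
  | nil => simp [Function.End.one_def]
  | append_singleton ω i ih =>
    have hiff : (cs.wordProd ω)⁻¹ * (x.1 * cs.wordProd ω) = cs.simple i ↔
        cs.wordProd ω * (cs.simple i * (cs.wordProd ω)⁻¹) = x.1 := by
      rw [inv_mul_eq_iff_eq_mul, ← mul_assoc, mul_inv_eq_iff_eq_mul, eq_comm]
    rw [List.reverse_concat', List.map_cons, List.prod_cons]
    change signedReflection cs i ((ω.reverse.map (signedReflection cs)).prod x) = _
    rw [ih, ← List.concat_eq_append, leftInvSeq_concat, wordProd_concat]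
    simp [signedReflection, hiff, mul_assoc, List.count_singleton, add_assoc]

theorem signedReflection_mul_pow (i j : B) (m : ℕ) :
    (signedReflection cs i * signedReflection cs j) ^ m =
      ((alternatingWord j i (2 * m)).reverse.map (signedReflection cs)).prod := by
  induction m with
  | zero => rfl
  | succ m ih =>
    rw [pow_succ', ih, mul_add_one, alternatingWord_succ, alternatingWord_succ]
    simp [mul_assoc]

theorem leftInvSeq_alternatingWord_two_mul (i j : B) :
    ∃ l, cs.leftInvSeq (alternatingWord i j (2 * M i j)) = l ++ l := by
  refine ⟨(cs.leftInvSeq (alternatingWord i j (2 * M i j))).take (M i j),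
    List.ext_getElem (by simp; lia) fun k hk _ => ?_⟩
  rw [length_leftInvSeq, length_alternatingWord] at hk
  have period (k : ℕ) : cs.wordProd (alternatingWord j i (2 * (k + M i j) + 1)) =
      cs.wordProd (alternatingWord j i (2 * k + 1)) := by
    have hdiv (n : ℕ) : (2 * n + 1) / 2 = n := by lia
    rw [prod_alternatingWord_eq_mul_pow, prod_alternatingWord_eq_mul_pow, hdiv, hdiv, pow_add,
      cs.simple_mul_simple_pow', mul_one]
    simp [parity_simps]
  rw [List.getElem_append]
  split_ifs with hkM
  · rw [List.getElem_take]
  · rw [List.length_take, length_leftInvSeq, length_alternatingWord, min_eq_left (by lia)] at hkM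
    obtain ⟨k, rfl⟩ := Nat.exists_eq_add_of_le' (not_lt.1 hkM)
    have hmin : min (M i j) (2 * M i j) = M i j := min_eq_left (by lia)
    simp only [List.length_take, length_leftInvSeq, length_alternatingWord, List.getElem_take,
      hmin, Nat.add_sub_cancel]
    rw [getElem_leftInvSeq_alternatingWord cs i j _ _ hk, period,
      getElem_leftInvSeq_alternatingWord cs i j _ _ (by lia)]

theorem isLiftable_signedReflection : M.IsLiftable (signedReflection cs) := by
  classical
  intro i j
  rw [signedReflection_mul_pow, M.symmetric i j]
  funext x
  obtain ⟨l, hl⟩ := leftInvSeq_alternatingWord_two_mul cs j i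
  have hone : cs.wordProd (alternatingWord j i (2 * M j i)) = 1 := by
    simp [prod_alternatingWord_eq_mul_pow]
  rw [prod_map_signedReflection, hl, hone, List.count_append, Nat.cast_add,
    CharTwo.add_self_eq_zero]
  simp [Function.End.one_def]

/-- The number modulo two of occurrences of `t` in the left inversion sequence of any word for `w`.
For a reflection `t` it vanishes exactly when `w` lies in the half-space of `t` containing `1`. -/
def inversionParity (w t : W) : ZMod 2 :=
  (cs.lift ⟨signedReflection cs, isLiftable_signedReflection cs⟩ w⁻¹ (t, 0)).2

open scoped Classical in
theorem inversionParity_wordProd (ω : List B) (t : W) :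
    inversionParity cs (cs.wordProd ω) t = (cs.leftInvSeq ω).count t := by
  have hlift : cs.lift ⟨signedReflection cs, isLiftable_signedReflection cs⟩
      (cs.wordProd ω)⁻¹ = (ω.reverse.map (signedReflection cs)).prod := by
    rw [← wordProd_reverse, wordProd, map_list_prod, List.map_map]
    congr 2
    funext i
    exact cs.lift_apply_simple _ i
  rw [inversionParity, hlift, prod_map_signedReflection, zero_add]

theorem inversionParity_one (t : W) : inversionParity cs 1 t = 0 := by
  simpa using inversionParity_wordProd cs [] t

theorem inversionParity_simple_mul (i : B) (w : W) :
    inversionParity cs (cs.simple i * w) (cs.simple i) =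
      inversionParity cs w (cs.simple i) + 1 := by
  classical
  obtain ⟨ω, rfl⟩ := cs.wordProd_surjective w
  have hcount : ((cs.leftInvSeq ω).map (MulAut.conj (cs.simple i))).count (cs.simple i) =
      (cs.leftInvSeq ω).count (cs.simple i) := by
    simpa using List.count_map_of_injective (cs.leftInvSeq ω) (MulAut.conj (cs.simple i))
      (MulEquiv.injective _) (cs.simple i)
  rw [← wordProd_cons, inversionParity_wordProd, inversionParity_wordProd, leftInvSeq,
    List.count_cons_self, hcount, Nat.cast_add_one]

theorem inversionParity_mul_simple {w t : W} {j : B}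
    (hne : w * cs.simple j * w⁻¹ ≠ t) :
    inversionParity cs (w * cs.simple j) t = inversionParity cs w t := by
  classical
  obtain ⟨ω, rfl⟩ := cs.wordProd_surjective w
  rw [← wordProd_concat, inversionParity_wordProd, inversionParity_wordProd, leftInvSeq_concat,
    List.concat_eq_append, List.count_append, List.count_singleton]
  simp [hne]

theorem isCoxeter_range_simple : IsCoxeter (Set.range cs.simple) := by
  refine .of_halfSpaces ⟨?_, cs.subgroup_closure_range_simple⟩
    (fun s w => inversionParity cs w s = 0) (fun s _ => inversionParity_one cs s) ?_ ?_
  · rintro _ ⟨i, rfl⟩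
    exact cs.simple_mul_simple_self i
  · rintro _ ⟨i, rfl⟩ w hw
    simp [inversionParity_simple_mul, hw]
  · rintro _ ⟨i, rfl⟩ _ ⟨j, rfl⟩ w hw hwj
    by_contra hne
    refine hwj ((inversionParity_mul_simple cs fun heq => hne ?_).trans hw)
    rw [← heq, inv_mul_cancel_right]

end CoxeterSystem

section FixedPoints

variable {W : Type*} [Group W] {S : Set W}

theorem IsCoxeter.conj_mem_closure_of_ascents_of_descents (hS : IsCoxeter S) {I J : Set W}
    (hI : I ⊆ S) (hJ : J ⊆ S) {w y : W} (hy : y ∈ Subgroup.closure J)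
    (hw : ∀ s ∈ I, ℓ[S] w < ℓ[S] (s * w))
    (hwy : ∀ s ∈ I, ℓ[S] (s * (w * y)) < ℓ[S] (w * y)) {x : W} (hx : x ∈ Subgroup.closure I) :
    w⁻¹ * x * w ∈ Subgroup.closure J := by
  have hle : Subgroup.closure I ≤
      (Subgroup.closure J).comap (MulAut.conj w⁻¹).toMonoidHom := by
    refine (Subgroup.closure_le _).2 fun s hs => ?_
    obtain ⟨l, hl, rfl, -⟩ := hS.exists_reduced_word_of_mem_closure hJ hy
    obtain ⟨l', hsub, -, hprod⟩ :=
      hS.exchange (hI hs) (fun t ht => hJ (hl t ht)) (hw s hs) (hwy s hs)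
    have hconj : w⁻¹ * s * w = l'.prod * l.prod⁻¹ := by
      rw [eq_mul_inv_iff_mul_eq, mul_assoc, mul_assoc, hprod, inv_mul_cancel_left]
    simpa [hconj] using mul_mem (Subgroup.list_prod_mem _ fun t ht =>
      Subgroup.subset_closure (hl t (hsub.subset ht))) (inv_mem hy)
  simpa using hle hx

theorem IsCoxeter.wordLength_eq_add_of_isLongest (hS : IsCoxeter S) {I : Set W} (hI : I ⊆ S)
    {x w : W} (hx : IsLongest S I x) (hw : ∀ s ∈ I, ℓ[S] (s * w) < ℓ[S] w) :
    ℓ[S] w = ℓ[S] x + ℓ[S] (x * w) := by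
  obtain ⟨d, rfl, hlen⟩ := hS.exists_reduced_factorization_of_descents hI hw hx.1
  rw [hlen, ← mul_assoc, hS.mul_self_of_isLongest hI hx, one_mul]

theorem IsCoxeter.wordLength_pos_of_isLongest (hS : IsCoxeter S) {I : Set W} (hI : I ⊆ S)
    (hne : I.Nonempty) {x : W} (hx : IsLongest S I x) : 0 < ℓ[S] x := by
  obtain ⟨s, hs⟩ := hne
  exact (Nat.zero_le _).trans_lt (hS.descent_of_isLongest hI hx hs)

theorem GeneratedByInvolutions.wordLength_map_le (hS : GeneratedByInvolutions S) {σ : MulAut W}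
    (hσ : (fun w => σ w) '' S = S) (w : W) : ℓ[S] (σ w) ≤ ℓ[S] w := by
  obtain ⟨l, hl, rfl, hlen⟩ := hS.exists_reduced_word w
  rw [← hlen, map_list_prod, ← List.length_map (as := l) σ]
  refine wordLength_prod_le fun s hs => ?_
  obtain ⟨t, ht, rfl⟩ := List.mem_map.1 hs
  exact hσ ▸ ⟨t, hl t ht, rfl⟩

variable {G : Subgroup (MulAut W)}

theorem smul_mem_closure_orbit (σ : G) {s w : W}
    (hw : w ∈ Subgroup.closure (MulAction.orbit G s)) :
    σ • w ∈ Subgroup.closure (MulAction.orbit G s) := by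
  induction hw using Subgroup.closure_induction with
  | mem x hx => exact Subgroup.subset_closure (MulAction.mem_orbit_of_mem_orbit σ hx)
  | one => rw [smul_one]; exact one_mem _
  | mul x y _ _ hx hy => rw [smul_mul']; exact mul_mem hx hy
  | inv x _ hx => rw [smul_inv']; exact inv_mem hx

variable (hS : IsCoxeter S) (hGS : ∀ σ ∈ G, (fun w => σ w) '' S = S)

include hGS

theorem orbit_subset {s : W} (hs : s ∈ S) : MulAction.orbit G s ⊆ S := by
  rintro _ ⟨σ, rfl⟩
  exact (hGS σ σ.2).subset ⟨s, hs, rfl⟩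

include hS

theorem wordLength_smul (σ : G) (w : W) : ℓ[S] (σ • w) = ℓ[S] w := by
  have smul_le (σ : G) (w : W) : ℓ[S] (σ • w) ≤ ℓ[S] w := hS.wordLength_map_le (hGS σ σ.2) w
  refine le_antisymm (smul_le σ w) ?_
  simpa using smul_le σ⁻¹ (σ • w)

theorem forall_descent_of_descent {s : W} (w : FixedPoints.subgroup G W)
    {t : W} (ht : t ∈ MulAction.orbit G s) (hw : ℓ[S] (t * w) < ℓ[S] (w : W)) :
    ∀ u ∈ MulAction.orbit G s, ℓ[S] (u * w) < ℓ[S] (w : W) := by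
  intro u hu
  rw [← MulAction.orbit_eq_iff.2 ht] at hu
  obtain ⟨σ, rfl⟩ := hu
  have hsmul : σ • t * (w : W) = σ • (t * (w : W)) := by rw [smul_mul', w.2 σ]
  change ℓ[S] (σ • t * w) < _
  rwa [hsmul, wordLength_smul hS hGS]

theorem forall_descent_or_forall_ascent {s : W} (hs : s ∈ S) (w : FixedPoints.subgroup G W) :
    (∀ u ∈ MulAction.orbit G s, ℓ[S] (u * w) < ℓ[S] (w : W)) ∨
      ∀ u ∈ MulAction.orbit G s, ℓ[S] (w : W) < ℓ[S] (u * w) := by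
  by_cases hdescent : ∃ t ∈ MulAction.orbit G s, ℓ[S] (t * w) < ℓ[S] (w : W)
  · obtain ⟨t, ht, hlt⟩ := hdescent
    exact Or.inl (forall_descent_of_descent hS hGS w ht hlt)
  · push Not at hdescent
    exact Or.inr fun u hu => (hdescent u hu).lt_of_ne
      (hS.wordLength_simple_mul_ne u (orbit_subset hGS hs hu) w).symm

section IsLongest

variable {s x : W} (hs : s ∈ S) (hx : IsLongest S (MulAction.orbit G s) x)

include hs hx

theorem wordLength_pos_of_isLongest_orbit : 0 < ℓ[S] x :=
  hS.wordLength_pos_of_isLongest (orbit_subset hGS hs) ⟨s, MulAction.mem_orbit_self s⟩ hx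

theorem forall_ascent_of_lt_wordLength_mul {w : FixedPoints.subgroup G W}
    (hw : ℓ[S] (w : W) < ℓ[S] (x * w)) :
    ∀ u ∈ MulAction.orbit G s, ℓ[S] (w : W) < ℓ[S] (u * w) := by
  refine (forall_descent_or_forall_ascent hS hGS hs w).resolve_left fun hdescents => ?_
  have := hS.wordLength_eq_add_of_isLongest (orbit_subset hGS hs) hx hdescents
  lia

theorem forall_descent_of_wordLength_mul_le {w : FixedPoints.subgroup G W}
    (hw : ℓ[S] (x * w) ≤ ℓ[S] (w : W)) :
    ∀ u ∈ MulAction.orbit G s, ℓ[S] (u * w) < ℓ[S] (w : W) := by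
  refine (forall_descent_or_forall_ascent hS hGS hs w).resolve_right fun hascents => ?_
  have := hS.wordLength_mul_of_ascents (orbit_subset hGS hs) hascents hx.1
  have := wordLength_pos_of_isLongest_orbit hS hGS hs hx
  lia

theorem eq_one_or_eq_of_mem_closure_orbit {w : FixedPoints.subgroup G W}
    (hw : (w : W) ∈ Subgroup.closure (MulAction.orbit G s)) : w = 1 ∨ (w : W) = x := by
  refine or_iff_not_imp_left.2 fun hne => ?_
  have hI := orbit_subset hGS hs
  obtain ⟨t, ht, hdescent⟩ := hS.exists_descent hI hw (by simpa using hne)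
  exact hS.eq_of_isLongest_of_descents hI hx hw (forall_descent_of_descent hS hGS w ht hdescent)

theorem mem_fixedPoints_of_isLongest_orbit : x ∈ FixedPoints.subgroup G W := by
  intro σ
  have hσx : IsLongest S (MulAction.orbit G s) (σ • x) :=
    ⟨smul_mem_closure_orbit σ hx.1, fun v hv => (wordLength_smul hS hGS σ x).symm ▸ hx.2 v hv⟩
  have hI := orbit_subset hGS hs
  exact hS.eq_of_isLongest_of_descents hI hx hσx.1 fun t => hS.descent_of_isLongest hI hσx

end IsLongest

theorem wordLength_pos_of_mem_fixedSimple {x : FixedPoints.subgroup G W}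
    (hx : x ∈ fixedSimple S G) : 0 < ℓ[S] (x : W) := by
  obtain ⟨s, hs, -, hx⟩ := hx
  exact wordLength_pos_of_isLongest_orbit hS hGS hs hx

theorem mul_self_of_mem_fixedSimple {x : FixedPoints.subgroup G W}
    (hx : x ∈ fixedSimple S G) : x * x = 1 := by
  obtain ⟨s, hs, -, hx⟩ := hx
  exact Subtype.ext (hS.mul_self_of_isLongest (orbit_subset hGS hs) hx)

theorem wordLength_mul_of_mem_fixedSimple {x w : FixedPoints.subgroup G W}
    (hx : x ∈ fixedSimple S G) (hw : ℓ[S] (w : W) < ℓ[S] (x * w : W)) :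
    ℓ[S] (x * w : W) = ℓ[S] (x : W) + ℓ[S] (w : W) := by
  obtain ⟨s, hs, -, hx⟩ := hx
  exact hS.wordLength_mul_of_ascents (orbit_subset hGS hs)
    (forall_ascent_of_lt_wordLength_mul hS hGS hs hx hw) hx.1

theorem fixedSimple_fold {x y w : FixedPoints.subgroup G W}
    (hx : x ∈ fixedSimple S G) (hy : y ∈ fixedSimple S G)
    (hw : ℓ[S] (w : W) < ℓ[S] (x * w : W))
    (hwy : ¬ ℓ[S] (w * y : W) < ℓ[S] (x * (w * y) : W)) : x * w = w * y := by
  have hx_pos := wordLength_pos_of_mem_fixedSimple hS hGS hx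
  obtain ⟨s, hs, -, hx⟩ := hx
  obtain ⟨t, ht, -, hy⟩ := hy
  have hmem : (w : W)⁻¹ * x * w ∈ Subgroup.closure (MulAction.orbit G t) :=
    hS.conj_mem_closure_of_ascents_of_descents (orbit_subset hGS hs) (orbit_subset hGS ht) hy.1
      (forall_ascent_of_lt_wordLength_mul hS hGS hs hx hw)
      (forall_descent_of_wordLength_mul_le hS hGS hs hx (w := w * y) (not_lt.1 hwy)) hx.1
  rcases eq_one_or_eq_of_mem_closure_orbit hS hGS ht hy (w := w⁻¹ * x * w) hmem with hone | heq
  · have hx_one : x = 1 := by simpa [mul_assoc, inv_mul_eq_one, eq_comm] using hone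
    simp [hx_one, wordLength_one] at hx_pos
  · rw [← (Subtype.ext heq : w⁻¹ * x * w = y)]
    group

theorem not_lt_wordLength_mul_mul {x w : FixedPoints.subgroup G W} (hx : x ∈ fixedSimple S G)
    (hw : ℓ[S] (w : W) < ℓ[S] (x * w : W)) :
    ¬ ℓ[S] (x * w : W) < ℓ[S] (x * (x * w : W)) := by
  have hxx : (x : W) * x = 1 := congrArg Subtype.val (mul_self_of_mem_fixedSimple hS hGS hx)
  rw [← mul_assoc, hxx, one_mul]
  exact hw.not_gt

variable [Finite G]

theorem exists_fixedSimple_descent {w : FixedPoints.subgroup G W} (hw : w ≠ 1) :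
    ∃ x ∈ fixedSimple S G, ℓ[S] (x * w : W) < ℓ[S] (w : W) := by
  obtain ⟨s, hs, hsw⟩ := hS.exists_descent subset_rfl (c := (w : W))
    (hS.closure_eq_top ▸ Subgroup.mem_top _) (by simpa using hw)
  have hI := orbit_subset hGS hs
  have hdescents := forall_descent_of_descent hS hGS w (MulAction.mem_orbit_self s) hsw
  have hfin := hS.finite_closure_of_descents hI (Set.finite_range _) hdescents
  obtain ⟨x, hx⟩ := exists_isLongest_of_finite_closure (S := S) hfin
  refine ⟨⟨x, mem_fixedPoints_of_isLongest_orbit hS hGS hs hx⟩, ⟨s, hs, hfin, hx⟩, ?_⟩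
  have hlen := hS.wordLength_eq_add_of_isLongest hI hx hdescents
  have hpos := wordLength_pos_of_isLongest_orbit hS hGS hs hx
  exact hlen ▸ Nat.lt_add_of_pos_left hpos

theorem generatedByInvolutions_fixedSimple : GeneratedByInvolutions (fixedSimple S G) where
  mul_self _ hx := mul_self_of_mem_fixedSimple hS hGS hx
  closure_eq_top := by
    rw [eq_top_iff]
    rintro w -
    induction hn : ℓ[S] (w : W) using Nat.strong_induction_on generalizing w with
    | _ n ih =>
      by_cases hw : w = 1
      · exact hw ▸ one_mem _
      · obtain ⟨x, hx, hlt⟩ := exists_fixedSimple_descent hS hGS hw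
        have hxw := ih _ (hn ▸ hlt) (w := x * w) rfl
        exact (Subgroup.mul_mem_cancel_left _ (Subgroup.subset_closure hx)).1 hxw

theorem isCoxeter_fixedSimple : IsCoxeter (fixedSimple S G) :=
  .of_halfSpaces (generatedByInvolutions_fixedSimple hS hGS)
    (fun x w => ℓ[S] (w : W) < ℓ[S] (x * w : W))
    (fun x hx => by simpa [wordLength_one] using wordLength_pos_of_mem_fixedSimple hS hGS hx)
    (fun _ hx _ hw => not_lt_wordLength_mul_mul hS hGS hx hw)
    fun _ hx _ hy _ hw hwy => fixedSimple_fold hS hGS hx hy hw hwy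

theorem wordLength_lt_fixedSimple_mul_iff {x : FixedPoints.subgroup G W}
    (hx : x ∈ fixedSimple S G) {w : FixedPoints.subgroup G W} :
    ℓ[fixedSimple S G] w < ℓ[fixedSimple S G] (x * w) ↔ ℓ[S] (w : W) < ℓ[S] (x * w : W) :=
  (generatedByInvolutions_fixedSimple hS hGS).lt_wordLength_simple_mul_iff_of_halfSpace hx
    (H := fun w => ℓ[S] (w : W) < ℓ[S] (x * w : W))
    (by simpa [wordLength_one] using wordLength_pos_of_mem_fixedSimple hS hGS hx)
    (fun _ hw => not_lt_wordLength_mul_mul hS hGS hx hw)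
    fun _ hy _ hw hwy => fixedSimple_fold hS hGS hx hy hw hwy

theorem wordLength_mul_of_wordLength_fixedSimple_mul {w w' : FixedPoints.subgroup G W}
    (hw : ℓ[fixedSimple S G] (w * w') = ℓ[fixedSimple S G] w + ℓ[fixedSimple S G] w') :
    ℓ[S] (w * w' : W) = ℓ[S] (w : W) + ℓ[S] (w' : W) := by
  have hSG := isCoxeter_fixedSimple hS hGS
  have simple_mul {x w} (hx : x ∈ fixedSimple S G)
      (hw : ℓ[fixedSimple S G] w < ℓ[fixedSimple S G] (x * w)) :
      ℓ[S] (x * w : W) = ℓ[S] (x : W) + ℓ[S] (w : W) :=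
    wordLength_mul_of_mem_fixedSimple hS hGS hx
      ((wordLength_lt_fixedSimple_mul_iff hS hGS hx).1 hw)
  induction w using hSG.induction_left with
  | one => simp [wordLength_one]
  | simple_mul x hx c hxc ih =>
    have hle_xcw := hSG.wordLength_mul_le x (c * w')
    have hle_cw := hSG.wordLength_mul_le c w'
    have hx_one := hSG.wordLength_simple hx
    rw [mul_assoc] at hw
    have hlen_xcw := simple_mul hx (w := c * w') (by lia)
    rw [Subgroup.coe_mul] at hlen_xcw
    rw [Subgroup.coe_mul, mul_assoc, hlen_xcw, ih (by lia), simple_mul hx (by lia), add_assoc]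

theorem isWeightFunction_fixedWeight {Γ : Type*} [Add Γ] {φ : W → Γ}
    (hφ : IsWeightFunction S φ) : IsWeightFunction (fixedSimple S G) (fixedWeight φ G) :=
  fun w w' hw => hφ w w' (wordLength_mul_of_wordLength_fixedSimple_mul hS hGS hw)

end FixedPoints

noncomputable section StandardBasis

variable {W : Type*} [Group W] {Γ : Type*} [AddCommGroup Γ] {S : Set W} {φ : W → Γ}

theorem expo_zero : expo (0 : Γ) = 1 := rfl

theorem expo_add (a b : Γ) : expo (a + b) = expo a * expo b := by
  simp [expo, AddMonoidAlgebra.single_mul_single]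

theorem expo_mul_expo_neg (a : Γ) : expo a * expo (-a) = 1 := by
  rw [← expo_add, add_neg_cancel, expo_zero]

/-- The coefficient `e ^ φ(s) - e ^ (-φ(s))` in `T_s ^ 2 = 1 + xi s • T_s`. -/
def xi (φ : W → Γ) (s : W) : ℤ[Γ] := expo (φ s) - expo (-φ s)

section Presentation

theorem mk_eq_of_rel {a b : FreeAlgebra ℤ[Γ] W} (h : HeckeRel S φ a b) :
    mk S φ a = mk S φ b :=
  RingQuot.mkAlgHom_rel ℤ[Γ] h

theorem T_one : T S φ 1 = 1 := by
  rw [T, mk_eq_of_rel HeckeRel.one, map_one]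

theorem T_mul {w w' : W} (h : ℓ[S] (w * w') = ℓ[S] w + ℓ[S] w') :
    T S φ w * T S φ w' = T S φ (w * w') := by
  rw [T, T, ← map_mul, mk_eq_of_rel (HeckeRel.mul w w' h), T]

theorem T_quadratic {s : W} (hs : s ∈ S) :
    (T S φ s - algebraMap ℤ[Γ] _ (expo (φ s))) *
      (T S φ s + algebraMap ℤ[Γ] _ (expo (-φ s))) = 0 := by
  have hrel := mk_eq_of_rel (HeckeRel.quadratic (φ := φ) s hs)
  rwa [map_mul, map_sub, map_add, AlgHom.commutes, AlgHom.commutes, map_zero] at hrel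

theorem quadratic_eq_zero_iff {A R : Type*} [CommRing A] [Ring R] [Algebra A R] {a b : A}
    (hab : a * b = 1) (x : R) :
    (x - algebraMap A R a) * (x + algebraMap A R b) = 0 ↔ x * x = 1 + (a - b) • x := by
  have expand : (x - algebraMap A R a) * (x + algebraMap A R b) =
      x * x - (1 + (a - b) • x) := by
    rw [sub_mul, mul_add, mul_add, ← map_mul, hab, map_one, ← Algebra.commutes,
      Algebra.smul_def, map_sub, sub_mul]
    abel
  rw [expand, sub_eq_zero]

theorem T_mul_self {s : W} (hs : s ∈ S) : T S φ s * T S φ s = 1 + xi φ s • T S φ s :=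
  (quadratic_eq_zero_iff (expo_mul_expo_neg (φ s)) _).1 (T_quadratic hs)

/-- The homomorphism from the Hecke algebra defined by elements satisfying the relations of the
`T_w`. -/
def heckeLift {R : Type*} [Ring R] [Algebra ℤ[Γ] R] (f : W → R) (one : f 1 = 1)
    (mul : ∀ w w', ℓ[S] (w * w') = ℓ[S] w + ℓ[S] w' → f w * f w' = f (w * w'))
    (quadratic : ∀ s ∈ S, (f s - algebraMap ℤ[Γ] R (expo (φ s))) *
      (f s + algebraMap ℤ[Γ] R (expo (-φ s))) = 0) : Hecke S φ →ₐ[ℤ[Γ]] R :=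
  RingQuot.liftAlgHom ℤ[Γ] ⟨FreeAlgebra.lift ℤ[Γ] f, by
    rintro _ _ (_ | ⟨w, w', h⟩ | ⟨s, hs⟩)
    · simpa using one
    · simpa using mul w w' h
    · simpa using quadratic s hs⟩

theorem heckeLift_T {R : Type*} [Ring R] [Algebra ℤ[Γ] R] (f : W → R) (one mul quadratic)
    (w : W) : heckeLift (S := S) (φ := φ) f one mul quadratic (T S φ w) = f w :=
  (RingQuot.liftAlgHom_mkAlgHom_apply ℤ[Γ] (FreeAlgebra.lift ℤ[Γ] f) _ _).trans
    (FreeAlgebra.lift_ι_apply f w)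

theorem adjoin_T : Algebra.adjoin ℤ[Γ] (Set.range (T S φ)) = ⊤ := by
  have hrange : Set.range (T S φ) = mk S φ '' Set.range (FreeAlgebra.ι ℤ[Γ]) :=
    Set.range_comp (mk S φ) (FreeAlgebra.ι ℤ[Γ])
  rw [hrange, ← AlgHom.map_adjoin, FreeAlgebra.adjoin_range_ι, Algebra.map_top,
    AlgHom.range_eq_top]
  exact RingQuot.mkAlgHom_surjective _ _

end Presentation

section Span

theorem T_simple_mul_of_lt (hS : IsCoxeter S) {s w : W} (hs : s ∈ S)
    (hw : ℓ[S] w < ℓ[S] (s * w)) : T S φ s * T S φ w = T S φ (s * w) := by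
  have := hS.wordLength_simple hs
  have := hS.wordLength_simple_mul hs w
  exact T_mul (by lia)

theorem T_simple_mul_of_gt (hS : IsCoxeter S) {s w : W} (hs : s ∈ S)
    (hw : ℓ[S] (s * w) < ℓ[S] w) :
    T S φ s * T S φ w = T S φ (s * w) + xi φ s • T S φ w := by
  have hcancel := hS.simple_mul_cancel_left hs w
  have hsw : T S φ s * T S φ (s * w) = T S φ w := by
    rw [T_simple_mul_of_lt hS hs (by rwa [hcancel]), hcancel]
  rw [← hsw, ← mul_assoc, T_mul_self hs, add_mul, one_mul, smul_mul_assoc]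

theorem T_mul_mem_span_closure (hS : IsCoxeter S) {I : Set W} (hI : I ⊆ S) {c : W}
    (hc : c ∈ Subgroup.closure I) {x : Hecke S φ}
    (hx : x ∈ Submodule.span ℤ[Γ] (T S φ '' Subgroup.closure I)) :
    T S φ c * x ∈ Submodule.span ℤ[Γ] (T S φ '' Subgroup.closure I) := by
  have T_mem {w : W} (hw : w ∈ Subgroup.closure I) :
      T S φ w ∈ Submodule.span ℤ[Γ] (T S φ '' Subgroup.closure I) :=
    Submodule.subset_span ⟨w, hw, rfl⟩
  refine hS.closure_induction hI (p := fun c => T S φ c * x ∈ _) (by rwa [T_one, one_mul])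
    (fun s hs c _ hsc ih => ?_) hc
  rw [← T_simple_mul_of_lt hS (hI hs) (by lia), mul_assoc]
  generalize T S φ c * x = y at ih
  induction ih using Submodule.span_induction with
  | mem y hy =>
    obtain ⟨w, hw, rfl⟩ := hy
    have hsw := mul_mem (Subgroup.subset_closure hs) hw
    rcases (hS.wordLength_simple_mul_ne s (hI hs) w).lt_or_gt with hlt | hgt
    · exact T_simple_mul_of_gt (φ := φ) hS (hI hs) hlt ▸
        add_mem (T_mem hsw) (Submodule.smul_mem _ _ (T_mem hw))
    · exact T_simple_mul_of_lt (φ := φ) hS (hI hs) hgt ▸ T_mem hsw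
  | zero => simp
  | add x y _ _ hx hy => rw [mul_add]; exact add_mem hx hy
  | smul a x _ hx => rw [mul_smul_comm]; exact Submodule.smul_mem _ _ hx

theorem T_mul_mem_span (hS : IsCoxeter S) (w : W) {x : Hecke S φ}
    (hx : x ∈ Submodule.span ℤ[Γ] (Set.range (T S φ))) :
    T S φ w * x ∈ Submodule.span ℤ[Γ] (Set.range (T S φ)) := by
  have h := T_mul_mem_span_closure hS subset_rfl (c := w) (x := x)
  rw [hS.closure_eq_top, Subgroup.coe_top, Set.image_univ] at h
  exact h (Subgroup.mem_top w) hx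

theorem span_T (hS : IsCoxeter S) : Submodule.span ℤ[Γ] (Set.range (T S φ)) = ⊤ := by
  have mul_mem_span (x : Hecke S φ) : ∀ v ∈ Submodule.span ℤ[Γ] (Set.range (T S φ)),
      x * v ∈ Submodule.span ℤ[Γ] (Set.range (T S φ)) := by
    have hx : x ∈ Algebra.adjoin ℤ[Γ] (Set.range (T S φ)) := by
      rw [adjoin_T]
      exact Algebra.mem_top
    induction hx using Algebra.adjoin_induction with
    | mem x hx =>
      obtain ⟨w, rfl⟩ := hx
      exact fun v hv => T_mul_mem_span hS w hv
    | algebraMap a =>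
      intro v hv
      rw [← Algebra.smul_def]
      exact Submodule.smul_mem _ a hv
    | add x y _ _ hx hy =>
      intro v hv
      rw [add_mul]
      exact add_mem (hx v hv) (hy v hv)
    | mul x y _ _ hx hy =>
      intro v hv
      rw [mul_assoc]
      exact hx _ (hy v hv)
  refine eq_top_iff.2 fun x _ => ?_
  simpa using mul_mem_span x 1 (Submodule.subset_span ⟨1, T_one (S := S) (φ := φ)⟩)

end Span

section RegularRepresentation

/-- Left multiplication by `T_s` on the free module with basis `W`. -/
def leftOp (S : Set W) (φ : W → Γ) (s : W) : Module.End ℤ[Γ] (W →₀ ℤ[Γ]) :=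
  Finsupp.linearCombination ℤ[Γ] fun w => Finsupp.single (s * w) 1 +
    (if ℓ[S] (s * w) < ℓ[S] w then xi φ s else 0) • Finsupp.single w 1

/-- Right multiplication by `T_t` on the free module with basis `W`. -/
def rightOp (S : Set W) (φ : W → Γ) (t : W) : Module.End ℤ[Γ] (W →₀ ℤ[Γ]) :=
  Finsupp.linearCombination ℤ[Γ] fun w => Finsupp.single (w * t) 1 +
    (if ℓ[S] (w * t) < ℓ[S] w then xi φ t else 0) • Finsupp.single w 1

theorem leftOp_single (s w : W) : leftOp S φ s (Finsupp.single w 1) = Finsupp.single (s * w) 1 +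
    (if ℓ[S] (s * w) < ℓ[S] w then xi φ s else 0) • Finsupp.single w 1 := by
  rw [leftOp, Finsupp.linearCombination_single, one_smul]

theorem rightOp_single (t w : W) : rightOp S φ t (Finsupp.single w 1) =
    Finsupp.single (w * t) 1 +
    (if ℓ[S] (w * t) < ℓ[S] w then xi φ t else 0) • Finsupp.single w 1 := by
  rw [rightOp, Finsupp.linearCombination_single, one_smul]

theorem leftOp_single_of_lt {s w : W} (h : ℓ[S] w < ℓ[S] (s * w)) :
    leftOp S φ s (Finsupp.single w 1) = Finsupp.single (s * w) 1 := by
  rw [leftOp_single, if_neg h.not_gt, zero_smul, add_zero]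

theorem rightOp_single_of_lt {t w : W} (h : ℓ[S] w < ℓ[S] (w * t)) :
    rightOp S φ t (Finsupp.single w 1) = Finsupp.single (w * t) 1 := by
  rw [rightOp_single, if_neg h.not_gt, zero_smul, add_zero]

theorem leftOp_commute_rightOp (hS : IsCoxeter S) (hφ : IsWeightFunction S φ) {s t : W}
    (hs : s ∈ S) (ht : t ∈ S) : Commute (leftOp S φ s) (rightOp S φ t) := by
  refine Finsupp.lhom_ext' fun w => LinearMap.ext_ring ?_
  simp only [LinearMap.comp_apply, Finsupp.lsingle_apply, Module.End.mul_apply, leftOp_single,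
    rightOp_single, map_add, map_smul, ← mul_assoc]
  by_cases hw : s * w = w * t
  · have hxi : xi φ s = xi φ t := by
      rw [xi, xi, hS.weight_eq_of_simple_mul_eq_mul_simple hφ hs ht hw]
    rw [(by rw [hw, hS.simple_mul_cancel_right ht] : s * w * t = w), ← hw, hxi]
  · have left_iff : ℓ[S] (s * w * t) < ℓ[S] (w * t) ↔ ℓ[S] (s * w) < ℓ[S] w := by
      rw [mul_assoc]
      exact hS.wordLength_simple_mul_mul_lt_iff hs ht hw
    have right_iff : ℓ[S] (s * w * t) < ℓ[S] (s * w) ↔ ℓ[S] (w * t) < ℓ[S] w := by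
      have := hS.wordLength_simple_mul hs w
      have := hS.wordLength_simple_mul hs (w * t)
      have := hS.wordLength_mul_simple ht w
      have := hS.wordLength_mul_simple ht (s * w)
      rw [← mul_assoc] at *
      lia
    simp only [left_iff, right_iff]
    split_ifs <;> module

theorem leftOp_mem_centralizer (hS : IsCoxeter S) (hφ : IsWeightFunction S φ) {s : W}
    (hs : s ∈ S) : leftOp S φ s ∈ Subalgebra.centralizer ℤ[Γ] (rightOp S φ '' S) := by
  rintro _ ⟨t, ht, rfl⟩
  exact (leftOp_commute_rightOp hS hφ hs ht).eq.symm

theorem eq_of_mem_centralizer (hS : IsCoxeter S) {f g : Module.End ℤ[Γ] (W →₀ ℤ[Γ])}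
    (hf : f ∈ Subalgebra.centralizer ℤ[Γ] (rightOp S φ '' S))
    (hg : g ∈ Subalgebra.centralizer ℤ[Γ] (rightOp S φ '' S))
    (hfg : f (Finsupp.single 1 1) = g (Finsupp.single 1 1)) : f = g := by
  refine Finsupp.lhom_ext' fun w => LinearMap.ext_ring ?_
  simp only [LinearMap.comp_apply, Finsupp.lsingle_apply]
  induction w using hS.induction_right with
  | one => exact hfg
  | mul_simple t ht c hct ih =>
    rw [← rightOp_single_of_lt (S := S) (φ := φ) (by lia), ← Module.End.mul_apply,
      ← hf _ ⟨t, ht, rfl⟩, Module.End.mul_apply, ih, ← Module.End.mul_apply, hg _ ⟨t, ht, rfl⟩,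
      Module.End.mul_apply]

theorem exists_mem_centralizer (hS : IsCoxeter S) (hφ : IsWeightFunction S φ) (w : W) :
    ∃ f ∈ Subalgebra.centralizer ℤ[Γ] (rightOp S φ '' S),
      ∀ w', ℓ[S] (w * w') = ℓ[S] w + ℓ[S] w' →
        f (Finsupp.single w' 1) = Finsupp.single (w * w') 1 := by
  induction w using hS.induction_left with
  | one => exact ⟨1, one_mem _, fun w' _ => by simp⟩
  | simple_mul s hs c hsc ih =>
    obtain ⟨f, hf, hf_single⟩ := ih
    refine ⟨leftOp S φ s * f, mul_mem (leftOp_mem_centralizer hS hφ hs) hf, fun w' hw' => ?_⟩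
    have := hS.wordLength_mul_le c w'
    have := hS.wordLength_simple_mul hs (c * w')
    rw [mul_assoc] at hw'
    rw [Module.End.mul_apply, hf_single w' (by lia), leftOp_single_of_lt (by lia), mul_assoc]

theorem leftOp_single_one (hS : IsCoxeter S) {s : W} (hs : s ∈ S) :
    leftOp S φ s (Finsupp.single 1 1) = Finsupp.single s 1 := by
  rw [leftOp_single_of_lt, mul_one]
  simp [wordLength_one, hS.wordLength_simple hs]

theorem leftOp_mul_self (hS : IsCoxeter S) (hφ : IsWeightFunction S φ) {s : W} (hs : s ∈ S) :
    leftOp S φ s * leftOp S φ s = 1 + xi φ s • leftOp S φ s := by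
  have hmem := leftOp_mem_centralizer hS hφ hs
  refine eq_of_mem_centralizer hS (mul_mem hmem hmem)
    (add_mem (one_mem _) (Subalgebra.smul_mem _ hmem _)) ?_
  rw [Module.End.mul_apply, leftOp_single_one hS hs, leftOp_single, hS.mul_self s hs, if_pos,
    LinearMap.add_apply, LinearMap.smul_apply, leftOp_single_one hS hs, Module.End.one_apply]
  simp [wordLength_one, hS.wordLength_simple hs]

/-- The operators commuting with right multiplication are determined by the image of the basis
vector `1`, so the relations of the Hecke algebra need only be checked there. -/
theorem exists_regularRepresentation (hS : IsCoxeter S) (hφ : IsWeightFunction S φ) :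
    ∃ ρ : Hecke S φ →ₐ[ℤ[Γ]] Module.End ℤ[Γ] (W →₀ ℤ[Γ]),
      ∀ w, ρ (T S φ w) (Finsupp.single 1 1) = Finsupp.single w 1 := by
  choose f hf hf_single using exists_mem_centralizer hS hφ
  have hf_one : ∀ w, f w (Finsupp.single 1 1) = Finsupp.single w 1 := fun w => by
    simpa [wordLength_one] using hf_single w 1
  refine ⟨heckeLift f ?_ (fun w w' hw => ?_) (fun s hs => ?_), fun w => by
    rw [heckeLift_T, hf_one]⟩
  · exact eq_of_mem_centralizer hS (hf 1) (one_mem _) (hf_one 1)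
  · refine eq_of_mem_centralizer hS (mul_mem (hf w) (hf w')) (hf _) ?_
    rw [Module.End.mul_apply, hf_one, hf_one, hf_single w w' hw]
  · have hfs : f s = leftOp S φ s :=
      eq_of_mem_centralizer hS (hf s) (leftOp_mem_centralizer hS hφ hs)
        (by rw [hf_one, leftOp_single_one hS hs])
    rw [hfs]
    exact (quadratic_eq_zero_iff (expo_mul_expo_neg (φ s)) (leftOp S φ s)).2
      (leftOp_mul_self hS hφ hs)

end RegularRepresentation

theorem linearIndependent_T (hS : IsCoxeter S) (hφ : IsWeightFunction S φ) :
    LinearIndependent ℤ[Γ] (T S φ) := by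
  obtain ⟨ρ, hρ⟩ := exists_regularRepresentation hS hφ
  refine LinearIndependent.of_comp
    ((LinearMap.applyₗ (Finsupp.single (1 : W) (1 : ℤ[Γ]))).comp ρ.toLinearMap) ?_
  convert Finsupp.linearIndependent_single_one ℤ[Γ] W using 2 with w
  exact hρ w

/-- The basis `(T_w)` of the Hecke algebra. -/
def basisT (hS : IsCoxeter S) (hφ : IsWeightFunction S φ) :
    Module.Basis W ℤ[Γ] (Hecke S φ) :=
  Module.Basis.mk (linearIndependent_T hS hφ) (span_T hS).ge

theorem basisT_apply (hS : IsCoxeter S) (hφ : IsWeightFunction S φ) (w : W) :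
    basisT hS hφ w = T S φ w :=
  Module.Basis.mk_apply _ _ _

theorem coe_basisT (hS : IsCoxeter S) (hφ : IsWeightFunction S φ) :
    ⇑(basisT hS hφ) = T S φ :=
  funext (basisT_apply hS hφ)

end StandardBasis

section Basis

variable {ι A M : Type*}

theorem basis_repr_induction [Semiring A] [AddCommMonoid M] [Module A M] (b : Module.Basis ι A M)
    {p : M → Prop} (zero : p 0) (add : ∀ x y, p x → p y → p (x + y)) {x : M}
    (repr_smul : ∀ i, p (b.repr x i • b i)) : p x := by
  rw [← b.linearCombination_repr x, Finsupp.linearCombination_apply]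
  exact Finset.sum_induction _ p add zero fun i _ => repr_smul i

theorem natCast_dvd_iff_forall_repr [CommRing A] [Ring M] [Algebra A M]
    (b : Module.Basis ι A M) {n : ℕ} {x : M} :
    (n : M) ∣ x ↔ ∀ i, (n : A) ∣ b.repr x i := by
  constructor
  · rintro ⟨y, rfl⟩ i
    rw [← nsmul_eq_mul, map_nsmul, Finsupp.smul_apply, nsmul_eq_mul]
    exact dvd_mul_right _ _
  · intro h
    refine basis_repr_induction b (p := ((n : M) ∣ ·)) (dvd_zero _) (fun _ _ => dvd_add)
      fun i => ?_
    obtain ⟨a, ha⟩ := h i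
    rw [ha, mul_smul, Nat.cast_smul_eq_nsmul, nsmul_eq_mul]
    exact dvd_mul_right _ _

variable [Ring A] [AddCommGroup M] [Module A M]

theorem linearIndependent_of_unitriangular (b : Module.Basis ι A M) {c : ι → M} (rank : ι → ℕ)
    (hc : ∀ i, c i - b i ∈ Submodule.span A (b '' {j | rank j < rank i})) :
    LinearIndependent A c := by
  classical
  rw [linearIndependent_iff]
  intro f hf
  by_contra hf0
  obtain ⟨k, hk, hmax⟩ := Finset.exists_max_image f.support rank
    (Finsupp.support_nonempty_iff.2 hf0)
  have repr_c : ∀ i ∈ f.support, b.repr (c i) k = if i = k then 1 else 0 := by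
    intro i hi
    have hci : b.repr (c i - b i) k = 0 := by
      by_contra hne
      exact (hmax i hi).not_gt
        (b.mem_span_image.1 (hc i) (Finset.mem_coe.2 (Finsupp.mem_support_iff.2 hne)))
    rw [map_sub, Finsupp.sub_apply, sub_eq_zero] at hci
    rw [hci, Module.Basis.repr_self_apply]
  have hfk := congrArg (fun x => b.repr x k) hf
  simp only [Finsupp.linearCombination_apply, Finsupp.sum, map_sum, map_smul, map_zero,
    Finsupp.finsetSum_apply, Finsupp.smul_apply, Finsupp.zero_apply] at hfk
  rw [Finset.sum_congr rfl fun i hi => by rw [repr_c i hi]] at hfk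
  simp only [smul_eq_mul, mul_ite, mul_one, mul_zero, Finset.sum_ite_eq', if_pos hk] at hfk
  exact Finsupp.mem_support_iff.1 hk hfk

theorem span_eq_top_of_unitriangular (b : Module.Basis ι A M) {c : ι → M} (rank : ι → ℕ)
    (hc : ∀ i, c i - b i ∈ Submodule.span A (b '' {j | rank j < rank i})) :
    Submodule.span A (Set.range c) = ⊤ := by
  have span_le (n : ℕ) :
      Submodule.span A (b '' {j | rank j < n}) ≤ Submodule.span A (Set.range c) := by
    induction n with
    | zero => simp
    | succ n ih =>
      rw [Submodule.span_le]
      rintro _ ⟨i, hi, rfl⟩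
      have lower : c i - b i ∈ Submodule.span A (Set.range c) :=
        ih (Submodule.span_mono (Set.image_mono fun j (hj : rank j < rank i) =>
          hj.trans_le (Nat.le_of_lt_succ hi)) (hc i))
      rw [← sub_sub_cancel (c i) (b i)]
      exact sub_mem (Submodule.subset_span ⟨i, rfl⟩) lower
  rw [eq_top_iff, ← b.span_eq, Submodule.span_le]
  rintro _ ⟨i, rfl⟩
  exact span_le (rank i + 1) (Submodule.subset_span ⟨i, Nat.lt_succ_self _, rfl⟩)

end Basis

noncomputable section GroupAlgebra

variable {Γ : Type*} [AddCommGroup Γ]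

/-- The ring involution `e ^ γ ↦ e ^ (-γ)` of `ℤ[Γ]`. -/
def barA : ℤ[Γ] →+* ℤ[Γ] :=
  (AddMonoidAlgebra.mapDomainRingEquiv ℤ (AddEquiv.neg Γ) : ℤ[Γ] ≃+* ℤ[Γ])

theorem coeff_barA (a : ℤ[Γ]) (γ : Γ) : (barA a).coeff γ = a.coeff (-γ) := by
  simp only [barA, RingEquiv.coe_toRingHom, AddMonoidAlgebra.coeff_mapDomainRingEquiv,
    Finsupp.equivMapDomain_apply]
  rfl

theorem barA_expo (γ : Γ) : barA (expo γ) = expo (-γ) := by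
  classical
  ext δ
  simp only [coeff_barA, expo, AddMonoidAlgebra.coeff_single, Finsupp.single_apply,
    eq_neg_iff_add_eq_zero, neg_eq_iff_add_eq_zero, add_comm γ]

theorem ringHom_ext_expo {R : Type*} [Ring R] {f g : ℤ[Γ] →+* R}
    (h : ∀ γ, f (expo γ) = g (expo γ)) : f = g :=
  AddMonoidAlgebra.ringHom_ext (fun r => DFunLike.congr_fun (RingHom.ext_int
    (f.comp AddMonoidAlgebra.singleZeroRingHom) (g.comp AddMonoidAlgebra.singleZeroRingHom)) r) h

theorem coeff_natCast_mul (n : ℕ) (a : ℤ[Γ]) (γ : Γ) :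
    ((n : ℤ[Γ]) * a).coeff γ = n * a.coeff γ := by
  rw [← nsmul_eq_mul, AddMonoidAlgebra.coeff_smul_apply, nsmul_eq_mul]

theorem natCast_dvd_iff_forall_coeff {n : ℕ} {a : ℤ[Γ]} :
    (n : ℤ[Γ]) ∣ a ↔ ∀ γ, (n : ℤ) ∣ a.coeff γ := by
  constructor
  · rintro ⟨c, rfl⟩ γ
    exact ⟨c.coeff γ, coeff_natCast_mul n c γ⟩
  · intro h
    refine ⟨.ofCoeff (a.coeff.mapRange (· / (n : ℤ)) (Int.zero_ediv _)), ?_⟩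
    ext γ
    rw [coeff_natCast_mul, AddMonoidAlgebra.coeff_ofCoeff, Finsupp.mapRange_apply]
    exact (Int.mul_ediv_cancel' (h γ)).symm

variable [LinearOrder Γ]

/-- The projection of `ℤ[Γ]` onto `A_{<0} = ⊕_{γ < 0} ℤ e ^ γ`. -/
def negTrunc (a : ℤ[Γ]) : ℤ[Γ] := .ofCoeff (a.coeff.filter (· < 0))

theorem coeff_negTrunc (a : ℤ[Γ]) (γ : Γ) :
    (negTrunc a).coeff γ = if γ < 0 then a.coeff γ else 0 :=
  Finsupp.filter_apply _ _ _

theorem negTrunc_zero : negTrunc (0 : ℤ[Γ]) = 0 := by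
  ext γ
  simp [coeff_negTrunc]

variable [IsOrderedAddMonoid Γ]

theorem negTrunc_sub_barA {a : ℤ[Γ]} (ha : barA a = -a) :
    negTrunc a - barA (negTrunc a) = a := by
  ext γ
  have coeff_neg : a.coeff (-γ) = -a.coeff γ := by
    rw [← coeff_barA, ha, AddMonoidAlgebra.coeff_neg, Finsupp.neg_apply]
  simp only [AddMonoidAlgebra.coeff_sub, Finsupp.sub_apply, coeff_barA, coeff_negTrunc,
    Left.neg_neg_iff, coeff_neg]
  rcases lt_trichotomy γ 0 with hneg | rfl | hpos
  · simp [hneg, hneg.not_gt]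
  · rw [neg_zero] at coeff_neg
    simp only [lt_irrefl, if_false]
    lia
  · simp [hpos, hpos.not_gt]

theorem natCast_dvd_of_dvd_barA_sub {n : ℕ} {a : ℤ[Γ]} (ha : ∀ γ, 0 ≤ γ → a.coeff γ = 0)
    (hdvd : (n : ℤ[Γ]) ∣ barA a - a) : (n : ℤ[Γ]) ∣ a := by
  refine natCast_dvd_iff_forall_coeff.2 fun γ => ?_
  rcases le_or_gt 0 γ with hγ | hγ
  · exact ha γ hγ ▸ dvd_zero _
  · have := natCast_dvd_iff_forall_coeff.1 hdvd γ
    rwa [AddMonoidAlgebra.coeff_sub, Finsupp.sub_apply, coeff_barA,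
      ha (-γ) (neg_nonneg.2 hγ.le), zero_sub, dvd_neg] at this

end GroupAlgebra

noncomputable section Bar

variable {W : Type*} [Group W] {Γ : Type*} [AddCommGroup Γ] {S : Set W} {φ : W → Γ}

theorem hecke_ringHom_ext {R : Type*} [Ring R] {f g : Hecke S φ →+* R}
    (hexpo : ∀ γ, f (algebraMap ℤ[Γ] _ (expo γ)) = g (algebraMap ℤ[Γ] _ (expo γ)))
    (hT : ∀ w, f (T S φ w) = g (T S φ w)) : f = g := by
  have hscalar : f.comp (algebraMap ℤ[Γ] _) = g.comp (algebraMap ℤ[Γ] _) :=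
    ringHom_ext_expo hexpo
  ext x
  have hx : x ∈ Algebra.adjoin ℤ[Γ] (Set.range (T S φ)) := by
    rw [adjoin_T]
    exact Algebra.mem_top
  induction hx using Algebra.adjoin_induction with
  | mem x hx => obtain ⟨w, rfl⟩ := hx; exact hT w
  | algebraMap a => exact DFunLike.congr_fun hscalar a
  | add x y _ _ hx hy => rw [map_add, map_add, hx, hy]
  | mul x y _ _ hx hy => rw [map_mul, map_mul, hx, hy]

theorem T_simple_mul_sub {s : W} (hs : s ∈ S) :
    T S φ s * (T S φ s - algebraMap ℤ[Γ] _ (xi φ s)) = 1 := by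
  rw [mul_sub, T_mul_self hs, Algebra.smul_def, Algebra.commutes, add_sub_cancel_right]

theorem sub_mul_T_simple {s : W} (hs : s ∈ S) :
    (T S φ s - algebraMap ℤ[Γ] _ (xi φ s)) * T S φ s = 1 := by
  rw [sub_mul, T_mul_self hs, Algebra.smul_def, add_sub_cancel_right]

theorem isUnit_T (hS : IsCoxeter S) (w : W) : IsUnit (T S φ w) := by
  induction w using hS.induction_left with
  | one => exact T_one (S := S) (φ := φ) ▸ isUnit_one
  | simple_mul s hs c hsc ih =>
    rw [← T_simple_mul_of_lt hS hs (by lia)]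
    exact IsUnit.mul ⟨⟨_, _, T_simple_mul_sub hs, sub_mul_T_simple hs⟩, rfl⟩ ih

/-- The inverse of `T_{w⁻¹}`, the image of `T_w` under the bar involution. -/
def barT (hS : IsCoxeter S) (φ : W → Γ) (w : W) : Hecke S φ :=
  ((isUnit_T hS w⁻¹).unit⁻¹ : (Hecke S φ)ˣ)

theorem T_inv_mul_barT (hS : IsCoxeter S) (w : W) : T S φ w⁻¹ * barT hS φ w = 1 :=
  (isUnit_T hS w⁻¹).mul_val_inv

theorem barT_mul_T_inv (hS : IsCoxeter S) (w : W) : barT hS φ w * T S φ w⁻¹ = 1 :=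
  (isUnit_T hS w⁻¹).val_inv_mul

theorem barT_eq_of_mul_eq_one (hS : IsCoxeter S) {w : W} {x : Hecke S φ}
    (hx : T S φ w⁻¹ * x = 1) : barT hS φ w = x :=
  left_inv_eq_right_inv (barT_mul_T_inv hS w) hx

theorem barT_one (hS : IsCoxeter S) : barT hS φ 1 = 1 :=
  barT_eq_of_mul_eq_one hS (by rw [inv_one, T_one, one_mul])

theorem barT_mul (hS : IsCoxeter S) {w w' : W} (hw : ℓ[S] (w * w') = ℓ[S] w + ℓ[S] w') :
    barT hS φ w * barT hS φ w' = barT hS φ (w * w') := by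
  have hinv : ℓ[S] (w'⁻¹ * w⁻¹) = ℓ[S] w'⁻¹ + ℓ[S] w⁻¹ := by
    rw [← mul_inv_rev, hS.wordLength_inv, hS.wordLength_inv, hS.wordLength_inv, hw, add_comm]
  refine (barT_eq_of_mul_eq_one hS ?_).symm
  rw [mul_inv_rev, ← T_mul hinv, mul_assoc, ← mul_assoc (T S φ w⁻¹), T_inv_mul_barT, one_mul,
    T_inv_mul_barT]

theorem barT_simple (hS : IsCoxeter S) {s : W} (hs : s ∈ S) :
    barT hS φ s = T S φ s - algebraMap ℤ[Γ] _ (xi φ s) :=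
  barT_eq_of_mul_eq_one hS (by rw [hS.inv_eq hs, T_simple_mul_sub hs])

theorem barT_quadratic (hS : IsCoxeter S) {s : W} (hs : s ∈ S) :
    (barT hS φ s - algebraMap ℤ[Γ] _ (expo (-φ s))) *
      (barT hS φ s + algebraMap ℤ[Γ] _ (expo (φ s))) = 0 := by
  rw [barT_simple hS hs, xi, map_sub, ← T_quadratic hs]
  congr 1 <;> abel

/-- The Hecke algebra with the structure of `ℤ[Γ]`-algebra twisted by `barA`, which makes the bar
involution `ℤ[Γ]`-linear. -/
def BarHecke (S : Set W) (φ : W → Γ) : Type _ := Hecke S φ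

instance (S : Set W) (φ : W → Γ) : Ring (BarHecke S φ) := inferInstanceAs (Ring (Hecke S φ))

instance (S : Set W) (φ : W → Γ) : Algebra ℤ[Γ] (BarHecke S φ) :=
  RingHom.toAlgebra' ((algebraMap ℤ[Γ] (Hecke S φ)).comp barA)
    fun a x => Algebra.commutes (A := Hecke S φ) (barA a) x

theorem algebraMap_barHecke (γ : Γ) : algebraMap ℤ[Γ] (BarHecke S φ) (expo γ) =
    algebraMap ℤ[Γ] (Hecke S φ) (expo (-γ)) :=
  congrArg (algebraMap ℤ[Γ] (Hecke S φ)) (barA_expo γ)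

theorem exists_isBar (hS : IsCoxeter S) : ∃ β, IsBar S φ β := by
  let β : Hecke S φ →ₐ[ℤ[Γ]] BarHecke S φ :=
    heckeLift (barT hS φ) (barT_one hS) (fun _ _ => barT_mul hS) fun s hs => by
      rw [algebraMap_barHecke, algebraMap_barHecke, neg_neg]
      exact barT_quadratic hS hs
  let β' : Hecke S φ →+* Hecke S φ := β.toRingHom
  have β'_T (w : W) : β' (T S φ w) = barT hS φ w :=
    (heckeLift_T _ _ _ _ w : β (T S φ w) = barT hS φ w)
  refine ⟨β', fun γ => (β.commutes _).trans (algebraMap_barHecke γ), fun w => ?_⟩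
  rw [β'_T]
  exact ⟨barT_mul_T_inv hS w, T_inv_mul_barT hS w⟩

theorem IsBar.eq {β β' : Hecke S φ →+* Hecke S φ} (hβ : IsBar S φ β) (hβ' : IsBar S φ β') :
    β = β' :=
  hecke_ringHom_ext (fun γ => (hβ.1 γ).trans (hβ'.1 γ).symm)
    fun w => left_inv_eq_right_inv (hβ.2 w).1 (hβ'.2 w).2

theorem isBar_bar (hS : IsCoxeter S) : IsBar S φ (bar S φ) :=
  Classical.epsilon_spec (exists_isBar hS)

theorem bar_algebraMap (hS : IsCoxeter S) (a : ℤ[Γ]) :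
    bar S φ (algebraMap ℤ[Γ] _ a) = algebraMap ℤ[Γ] _ (barA a) := by
  have hcomp : (bar S φ).comp (algebraMap ℤ[Γ] _) = (algebraMap ℤ[Γ] _).comp barA :=
    ringHom_ext_expo fun γ => by
      rw [RingHom.comp_apply, RingHom.comp_apply, barA_expo, (isBar_bar hS).1]
  exact DFunLike.congr_fun hcomp a

theorem bar_smul (hS : IsCoxeter S) (a : ℤ[Γ]) (x : Hecke S φ) :
    bar S φ (a • x) = barA a • bar S φ x := by
  rw [Algebra.smul_def, map_mul, bar_algebraMap hS, Algebra.smul_def]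

theorem bar_bar (hS : IsCoxeter S) (x : Hecke S φ) : bar S φ (bar S φ x) = x := by
  have hbar := isBar_bar (φ := φ) hS
  have hcomp : (bar S φ).comp (bar S φ) = RingHom.id _ := by
    refine hecke_ringHom_ext (fun γ => ?_) fun w => ?_
    · simp only [RingHom.comp_apply, hbar.1, neg_neg, RingHom.id_apply]
    · have left_inv : bar S φ (bar S φ (T S φ w)) * bar S φ (T S φ w⁻¹) = 1 := by
        rw [← map_mul, (hbar.2 w).1, map_one]
      have right_inv : bar S φ (T S φ w⁻¹) * T S φ w = 1 := by
        simpa only [inv_inv] using (hbar.2 w⁻¹).1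
      exact left_inv_eq_right_inv left_inv right_inv
  exact DFunLike.congr_fun hcomp x

theorem bar_T_simple (hS : IsCoxeter S) {s : W} (hs : s ∈ S) :
    bar S φ (T S φ s) = T S φ s - algebraMap ℤ[Γ] _ (xi φ s) :=
  left_inv_eq_right_inv ((isBar_bar hS).2 s).1 (by rw [hS.inv_eq hs, T_simple_mul_sub hs])

end Bar

noncomputable section Filtration

variable {W : Type*} [Group W] {Γ : Type*} [AddCommGroup Γ] {S : Set W} {φ : W → Γ}

/-- The span of the `T_w` with `w` of length less than `n`. -/
def filt (S : Set W) (φ : W → Γ) (n : ℕ) : Submodule ℤ[Γ] (Hecke S φ) :=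
  Submodule.span ℤ[Γ] (T S φ '' {w | ℓ[S] w < n})

theorem T_mem_filt {w : W} {n : ℕ} (hw : ℓ[S] w < n) : T S φ w ∈ filt S φ n :=
  Submodule.subset_span ⟨w, hw, rfl⟩

theorem filt_mono : Monotone (filt S φ) := fun _ _ hmn =>
  Submodule.span_mono (Set.image_mono fun _ hw => lt_of_lt_of_le hw hmn)

theorem filt_zero : filt S φ 0 = ⊥ := by
  simp [filt]

theorem mem_filt_iff (hS : IsCoxeter S) (hφ : IsWeightFunction S φ) {n : ℕ} {x : Hecke S φ} :
    x ∈ filt S φ n ↔ ∀ w, n ≤ ℓ[S] w → (basisT hS hφ).repr x w = 0 := by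
  rw [filt, ← coe_basisT hS hφ, Module.Basis.mem_span_image]
  refine forall_congr' fun w => ?_
  rw [Finset.mem_coe, Finsupp.mem_support_iff, Set.mem_ofPred_eq, ← not_le, not_imp_not]

theorem exists_mem_filt (hS : IsCoxeter S) (hφ : IsWeightFunction S φ) (x : Hecke S φ) :
    ∃ n, x ∈ filt S φ n := by
  refine ⟨((basisT hS hφ).repr x).support.sup (wordLength S) + 1,
    (mem_filt_iff hS hφ).2 fun w hw => ?_⟩
  by_contra hne
  have := Finset.le_sup (f := wordLength S) (Finsupp.mem_support_iff.2 hne)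
  lia

theorem T_simple_mul_mem_filt (hS : IsCoxeter S) {s : W} (hs : s ∈ S) {n : ℕ} {x : Hecke S φ}
    (hx : x ∈ filt S φ n) : T S φ s * x ∈ filt S φ (n + 1) := by
  induction hx using Submodule.span_induction with
  | mem x hx =>
    obtain ⟨v, hv : ℓ[S] v < n, rfl⟩ := hx
    have := hS.wordLength_simple_mul hs v
    rcases (hS.wordLength_simple_mul_ne s hs v).lt_or_gt with hlt | hgt
    · exact T_simple_mul_of_gt (φ := φ) hS hs hlt ▸
        add_mem (T_mem_filt (by lia)) (Submodule.smul_mem _ _ (T_mem_filt (by lia)))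
    · exact T_simple_mul_of_lt (φ := φ) hS hs hgt ▸ T_mem_filt (by lia)
  | zero => simp
  | add x y _ _ hx hy => rw [mul_add]; exact add_mem hx hy
  | smul a x _ hx => rw [mul_smul_comm]; exact Submodule.smul_mem _ _ hx

theorem bar_T_sub_mem_filt (hS : IsCoxeter S) (w : W) :
    bar S φ (T S φ w) - T S φ w ∈ filt S φ (ℓ[S] w) := by
  induction w using hS.induction_left with
  | one => simp [T_one]
  | simple_mul s hs c hsc ih =>
    rw [← T_simple_mul_of_lt hS hs (by lia), map_mul, bar_T_simple hS hs, hsc]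
    set r := bar S φ (T S φ c) - T S φ c with hr
    have expand : (T S φ s - algebraMap ℤ[Γ] _ (xi φ s)) * bar S φ (T S φ c) -
        T S φ s * T S φ c = T S φ s * r - xi φ s • T S φ c - xi φ s • r := by
      rw [hr, Algebra.smul_def, Algebra.smul_def]
      noncomm_ring
    rw [expand]
    exact sub_mem (sub_mem (T_simple_mul_mem_filt hS hs ih)
      (Submodule.smul_mem _ _ (T_mem_filt (Nat.lt_succ_self _))))
      (Submodule.smul_mem _ _ (filt_mono (Nat.le_succ _) ih))

theorem bar_mem_filt (hS : IsCoxeter S) {n : ℕ} {x : Hecke S φ} (hx : x ∈ filt S φ n) :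
    bar S φ x ∈ filt S φ n := by
  induction hx using Submodule.span_induction with
  | mem x hx =>
    obtain ⟨v, hv, rfl⟩ := hx
    rw [← sub_add_cancel (bar S φ (T S φ v)) (T S φ v)]
    exact add_mem (filt_mono (le_of_lt hv) (bar_T_sub_mem_filt hS v)) (T_mem_filt hv)
  | zero => simp
  | add x y _ _ hx hy => rw [map_add]; exact add_mem hx hy
  | smul a x _ hx => rw [bar_smul hS]; exact Submodule.smul_mem _ _ hx

theorem natCast_dvd_repr_bar_sub (hS : IsCoxeter S) (hφ : IsWeightFunction S φ) {n : ℕ}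
    {x : Hecke S φ} {w : W} (hx : ∀ v, ℓ[S] w < ℓ[S] v → (n : ℤ[Γ]) ∣ (basisT hS hφ).repr x v) :
    (n : ℤ[Γ]) ∣ (basisT hS hφ).repr (bar S φ x) w - barA ((basisT hS hφ).repr x w) := by
  refine basis_repr_induction (basisT hS hφ) (p := fun y => (n : ℤ[Γ]) ∣
    (basisT hS hφ).repr (bar S φ y) w - barA ((basisT hS hφ).repr y w)) (by simp)
    (fun y z hy hz => by simpa [add_sub_add_comm] using dvd_add hy hz) fun v => ?_
  rw [bar_smul hS, map_smul, map_smul, Finsupp.smul_apply, Finsupp.smul_apply, smul_eq_mul,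
    smul_eq_mul, map_mul, ← mul_sub]
  rcases lt_or_ge (ℓ[S] w) (ℓ[S] v) with hwv | hvw
  · refine Dvd.dvd.mul_right ?_ _
    simpa only [map_natCast] using map_dvd barA (hx v hwv)
  · have hrepr := (mem_filt_iff hS hφ).1 (bar_T_sub_mem_filt hS v) w hvw
    rw [map_sub, Finsupp.sub_apply, sub_eq_zero] at hrepr
    classical
    rw [basisT_apply, hrepr, ← basisT_apply hS hφ, Module.Basis.repr_self_apply]
    split_ifs <;> simp

theorem repr_bar_of_mem_filt (hS : IsCoxeter S) (hφ : IsWeightFunction S φ) {x : Hecke S φ}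
    {w : W} (hx : x ∈ filt S φ (ℓ[S] w + 1)) :
    (basisT hS hφ).repr (bar S φ x) w = barA ((basisT hS hφ).repr x w) := by
  have := natCast_dvd_repr_bar_sub hS hφ (n := 0) (x := x) (w := w) fun v hv => by
    rw [(mem_filt_iff hS hφ).1 hx v hv]
    exact dvd_zero _
  rwa [Nat.cast_zero, zero_dvd_iff, sub_eq_zero] at this

end Filtration

noncomputable section KazhdanLusztig

variable {W : Type*} [Group W] {Γ : Type*} [AddCommGroup Γ] {S : Set W} {φ : W → Γ}

section NegPart

variable [LinearOrder Γ]

theorem smul_T_mem_negPart {a : ℤ[Γ]} (ha : ∀ γ, 0 ≤ γ → a.coeff γ = 0) (w : W) :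
    a • T S φ w ∈ negPart S φ := by
  rw [← AddMonoidAlgebra.sum_coeff_single a, Finsupp.sum, Finset.sum_smul]
  refine sum_mem fun γ hγ => ?_
  have hneg : γ < 0 := not_le.1 fun hle => Finsupp.mem_support_iff.1 hγ (ha γ hle)
  have hsingle : AddMonoidAlgebra.single γ (a.coeff γ) = a.coeff γ • expo γ := by
    rw [expo, AddMonoidAlgebra.smul_single, smul_eq_mul, mul_one]
  have hmem : expo γ • T S φ w ∈ negPart S φ := AddSubgroup.subset_closure ⟨γ, hneg, w, rfl⟩
  rw [hsingle, smul_assoc]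
  exact zsmul_mem hmem _

theorem mem_negPart_iff (hS : IsCoxeter S) (hφ : IsWeightFunction S φ) {x : Hecke S φ} :
    x ∈ negPart S φ ↔ ∀ w γ, 0 ≤ γ → ((basisT hS hφ).repr x w).coeff γ = 0 := by
  classical
  constructor
  · intro hx w γ hγ
    induction hx using AddSubgroup.closure_induction with
    | mem x hx =>
      obtain ⟨δ, hδ, v, rfl⟩ := hx
      rw [map_smul, ← basisT_apply hS hφ, Finsupp.smul_apply, Module.Basis.repr_self_apply]
      split_ifs <;> simp [expo, AddMonoidAlgebra.coeff_single, (hδ.trans_le hγ).ne]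
    | zero => simp
    | add x y _ _ hx hy => simp [hx, hy]
    | neg x _ hx => simp [hx]
  · intro hx
    refine basis_repr_induction (basisT hS hφ) (p := (· ∈ negPart S φ)) (zero_mem _)
      (fun _ _ => add_mem) fun w => ?_
    rw [basisT_apply]
    exact smul_T_mem_negPart (hx w) w

/-- The projection of the Hecke algebra onto `⊕_w A_{<0} T_w`. -/
def negProj (hS : IsCoxeter S) (hφ : IsWeightFunction S φ) (x : Hecke S φ) : Hecke S φ :=
  (basisT hS hφ).repr.symm (((basisT hS hφ).repr x).mapRange negTrunc negTrunc_zero)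

theorem repr_negProj (hS : IsCoxeter S) (hφ : IsWeightFunction S φ) (x : Hecke S φ) (w : W) :
    (basisT hS hφ).repr (negProj hS hφ x) w = negTrunc ((basisT hS hφ).repr x w) := by
  rw [negProj, LinearEquiv.apply_symm_apply, Finsupp.mapRange_apply]

theorem negProj_mem_negPart (hS : IsCoxeter S) (hφ : IsWeightFunction S φ) (x : Hecke S φ) :
    negProj hS hφ x ∈ negPart S φ :=
  (mem_negPart_iff hS hφ).2 fun w γ hγ => by
    rw [repr_negProj, coeff_negTrunc, if_neg hγ.not_gt]

theorem negProj_mem_filt (hS : IsCoxeter S) (hφ : IsWeightFunction S φ) {n : ℕ} {x : Hecke S φ}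
    (hx : x ∈ filt S φ n) : negProj hS hφ x ∈ filt S φ n :=
  (mem_filt_iff hS hφ).2 fun w hw => by
    rw [repr_negProj, (mem_filt_iff hS hφ).1 hx w hw, negTrunc_zero]

end NegPart

section Existence

variable [LinearOrder Γ] [IsOrderedAddMonoid Γ]

/-- At a `w` of maximal length in the support of `x` modulo `n`, the coefficient of `bar x` is the
conjugate of that of `x`, and an element of `A_{<0}` congruent to its conjugate vanishes modulo
`n`. -/
theorem natCast_dvd_of_dvd_bar_sub (hS : IsCoxeter S) (hφ : IsWeightFunction S φ) {n : ℕ}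
    {x : Hecke S φ} (hx : x ∈ negPart S φ) (hdvd : (n : Hecke S φ) ∣ bar S φ x - x) :
    (n : Hecke S φ) ∣ x := by
  obtain ⟨N, hN⟩ := exists_mem_filt hS hφ x
  have dvd_repr (k : ℕ) : ∀ w, N ≤ ℓ[S] w + k → (n : ℤ[Γ]) ∣ (basisT hS hφ).repr x w := by
    induction k with
    | zero => exact fun w hw => (mem_filt_iff hS hφ).1 hN w hw ▸ dvd_zero _
    | succ k ih =>
      intro w hw
      refine natCast_dvd_of_dvd_barA_sub ((mem_negPart_iff hS hφ).1 hx w) ?_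
      have hbar := natCast_dvd_repr_bar_sub hS hφ fun v (hv : ℓ[S] w < ℓ[S] v) =>
        ih v (by lia)
      have hsub := (natCast_dvd_iff_forall_repr (basisT hS hφ)).1 hdvd w
      rw [map_sub, Finsupp.sub_apply] at hsub
      convert dvd_sub hsub hbar using 1
      abel
  exact (natCast_dvd_iff_forall_repr (basisT hS hφ)).2 fun w => dvd_repr N w le_add_self

theorem eq_zero_of_bar_eq (hS : IsCoxeter S) (hφ : IsWeightFunction S φ) {x : Hecke S φ}
    (hx : x ∈ negPart S φ) (hbar : bar S φ x = x) : x = 0 := by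
  have := natCast_dvd_of_dvd_bar_sub hS hφ (n := 0) hx (by simp [hbar])
  rwa [Nat.cast_zero, zero_dvd_iff] at this

theorem sub_negProj_mem_filt (hS : IsCoxeter S) (hφ : IsWeightFunction S φ) {n : ℕ}
    {d : Hecke S φ} (hd : d ∈ filt S φ (n + 1)) (hbar : bar S φ d = -d) :
    d - (negProj hS hφ d - bar S φ (negProj hS hφ d)) ∈ filt S φ n := by
  have hproj := negProj_mem_filt hS hφ hd
  refine (mem_filt_iff hS hφ).2 fun w hw => ?_
  rcases hw.lt_or_eq with hlt | rfl
  · exact (mem_filt_iff hS hφ).1 (sub_mem hd (sub_mem hproj (bar_mem_filt hS hproj))) w hlt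
  · have hcoeff : barA ((basisT hS hφ).repr d w) = -(basisT hS hφ).repr d w := by
      rw [← repr_bar_of_mem_filt hS hφ hd, hbar, map_neg, Finsupp.neg_apply]
    rw [map_sub, map_sub, Finsupp.sub_apply, Finsupp.sub_apply,
      repr_bar_of_mem_filt hS hφ hproj, repr_negProj, negTrunc_sub_barA hcoeff, sub_self]

theorem exists_sub_bar_eq (hS : IsCoxeter S) (hφ : IsWeightFunction S φ) {n : ℕ}
    {d : Hecke S φ} (hd : d ∈ filt S φ n) (hbar : bar S φ d = -d) :
    ∃ b ∈ filt S φ n, b ∈ negPart S φ ∧ b - bar S φ b = d := by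
  induction n generalizing d with
  | zero =>
    rw [filt_zero, Submodule.mem_bot] at hd
    exact ⟨0, zero_mem _, zero_mem _, by simp [hd]⟩
  | succ n ih =>
    obtain ⟨b, hb, hb_neg, hb_eq⟩ := ih (sub_negProj_mem_filt hS hφ hd hbar)
      (by rw [map_sub, map_sub, bar_bar hS, hbar]; abel)
    refine ⟨negProj hS hφ d + b, add_mem (negProj_mem_filt hS hφ hd) (filt_mono n.le_succ hb),
      add_mem (negProj_mem_negPart hS hφ d) hb_neg, ?_⟩
    rw [map_add, add_sub_add_comm, hb_eq]
    abel

theorem IsKLElement.eq (hS : IsCoxeter S) (hφ : IsWeightFunction S φ) {w : W}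
    {c c' : Hecke S φ} (hc : IsKLElement S φ w c) (hc' : IsKLElement S φ w c') : c = c' := by
  rw [← sub_eq_zero]
  refine eq_zero_of_bar_eq hS hφ ?_ (by rw [map_sub, hc.1, hc'.1])
  rw [← sub_sub_sub_cancel_right c c' (T S φ w)]
  exact sub_mem hc.2 hc'.2

theorem exists_isKLElement (hS : IsCoxeter S) (hφ : IsWeightFunction S φ) (w : W) :
    ∃ c, IsKLElement S φ w c ∧ c - T S φ w ∈ filt S φ (ℓ[S] w) := by
  obtain ⟨b, hb, hb_neg, hb_eq⟩ := exists_sub_bar_eq hS hφ (bar_T_sub_mem_filt (φ := φ) hS w)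
    (by rw [map_sub, bar_bar hS]; abel)
  refine ⟨T S φ w + b, ⟨?_, by simpa using hb_neg⟩, by simpa using hb⟩
  rw [map_add, ← sub_eq_sub_iff_add_eq_add.1 hb_eq, add_comm]

theorem isKLElement_C (hS : IsCoxeter S) (hφ : IsWeightFunction S φ) (w : W) :
    IsKLElement S φ w (C S φ w) :=
  Classical.epsilon_spec ((exists_isKLElement hS hφ w).imp fun _ hc => hc.1)

theorem C_sub_T_mem_filt (hS : IsCoxeter S) (hφ : IsWeightFunction S φ) (w : W) :
    C S φ w - T S φ w ∈ filt S φ (ℓ[S] w) := by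
  obtain ⟨c, hc, hc_filt⟩ := exists_isKLElement hS hφ w
  rwa [(isKLElement_C hS hφ w).eq hS hφ hc]

theorem C_sub_basisT_mem_span (hS : IsCoxeter S) (hφ : IsWeightFunction S φ) (w : W) :
    C S φ w - basisT hS hφ w ∈
      Submodule.span ℤ[Γ] (basisT hS hφ '' {v | ℓ[S] v < ℓ[S] w}) := by
  rw [coe_basisT]
  exact C_sub_T_mem_filt hS hφ w

/-- The Kazhdan-Lusztig basis `(C_w)`. -/
def basisC (hS : IsCoxeter S) (hφ : IsWeightFunction S φ) :
    Module.Basis W ℤ[Γ] (Hecke S φ) :=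
  Module.Basis.mk
    (linearIndependent_of_unitriangular (basisT hS hφ) _ (C_sub_basisT_mem_span hS hφ))
    (span_eq_top_of_unitriangular (basisT hS hφ) _ (C_sub_basisT_mem_span hS hφ)).ge

theorem basisC_apply (hS : IsCoxeter S) (hφ : IsWeightFunction S φ) (w : W) :
    basisC hS hφ w = C S φ w :=
  Module.Basis.mk_apply _ _ _

theorem isStructureFamily_iff (hS : IsCoxeter S) (hφ : IsWeightFunction S φ) {x y : W}
    {f : W →₀ ℤ[Γ]} :
    IsStructureFamily S φ x y f ↔ f = (basisC hS hφ).repr (C S φ x * C S φ y) := by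
  rw [← (basisC hS hφ).repr.symm_apply_eq, Module.Basis.repr_symm_apply,
    Finsupp.linearCombination_apply, IsStructureFamily, eq_comm]
  simp only [basisC_apply]

theorem structureConst_eq (hS : IsCoxeter S) (hφ : IsWeightFunction S φ) (x y z : W) :
    structureConst S φ x y z = (basisC hS hφ).repr (C S φ x * C S φ y) z :=
  DFunLike.congr_fun ((isStructureFamily_iff hS hφ).1
    (Classical.epsilon_spec ⟨_, (isStructureFamily_iff hS hφ).2 rfl⟩)) z

end Existence

theorem isTau_iff (hS : IsCoxeter S) (hφ : IsWeightFunction S φ)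
    {t : Hecke S φ →ₗ[ℤ[Γ]] ℤ[Γ]} : IsTau S φ t ↔ t = (basisT hS hφ).coord 1 := by
  classical
  constructor
  · intro ht
    refine (basisT hS hφ).ext fun w => ?_
    rw [Module.Basis.coord_apply, Module.Basis.repr_self_apply, basisT_apply, ht w]
  · rintro rfl w
    rw [Module.Basis.coord_apply, ← basisT_apply hS hφ, Module.Basis.repr_self_apply]

theorem tau_apply (hS : IsCoxeter S) (hφ : IsWeightFunction S φ) (x : Hecke S φ) :
    tau S φ x = (basisT hS hφ).repr x 1 :=
  DFunLike.congr_fun ((isTau_iff hS hφ).1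
    (Classical.epsilon_spec ⟨_, (isTau_iff hS hφ).2 rfl⟩)) x

theorem wellDefined [LinearOrder Γ] [IsOrderedAddMonoid Γ] (hS : IsCoxeter S)
    (hφ : IsWeightFunction S φ) : WellDefined S φ where
  linearIndependent_T := linearIndependent_T hS hφ
  span_T := span_T hS
  bar := ⟨bar S φ, isBar_bar hS, fun _ hβ => hβ.eq (isBar_bar hS)⟩
  tau := ⟨_, (isTau_iff hS hφ).2 rfl, fun _ ht => (isTau_iff hS hφ).1 ht⟩
  C w := ⟨C S φ w, isKLElement_C hS hφ w, fun _ hc => hc.eq hS hφ (isKLElement_C hS hφ w)⟩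
  structureConst _ _ := ⟨_, (isStructureFamily_iff hS hφ).2 rfl,
    fun _ hf => (isStructureFamily_iff hS hφ).1 hf⟩

end KazhdanLusztig

section PGroup

theorem natCast_dvd_mul_of_dvd_right {R : Type*} [Semiring R] {n : ℕ} {b : R} (hb : (n : R) ∣ b)
    (a : R) : (n : R) ∣ a * b := by
  obtain ⟨c, rfl⟩ := hb
  exact ⟨a * c, by rw [← mul_assoc, ← (n.cast_commute a).eq, mul_assoc]⟩

theorem natCast_dvd_smul_of_dvd {A R : Type*} [CommSemiring A] [Semiring R] [Algebra A R] {n : ℕ}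
    {x : R} (hx : (n : R) ∣ x) (a : A) : (n : R) ∣ a • x := by
  rw [Algebra.smul_def]
  exact natCast_dvd_mul_of_dvd_right hx _

variable {p : ℕ} [Fact p.Prime] {G : Type*} [Group G] {X : Type*} [MulAction G X]

theorem natCast_dvd_sum_of_isPGroup (hG : IsPGroup p G) {R : Type*} [Semiring R] {s : Finset X}
    (hs : ∀ (σ : G), ∀ x ∈ s, σ • x ∈ s) {f : X → R} (hf : ∀ (σ : G) (x : X), f (σ • x) = f x)
    (hfixed : ∀ x ∈ s, (∀ σ : G, σ • x = x) → (p : R) ∣ f x) : (p : R) ∣ ∑ x ∈ s, f x := by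
  classical
  rw [Finset.sum_partition (MulAction.orbitRel G X)]
  refine Finset.dvd_sum fun o ho => ?_
  obtain ⟨x, hx, rfl⟩ := Finset.mem_image.1 ho
  set O := s.filter fun y => Quotient.mk (MulAction.orbitRel G X) y = Quotient.mk _ x with hO
  have coe_O : (O : Set X) = MulAction.orbit G x := by
    ext y
    simp only [hO, Finset.coe_filter, Quotient.eq, MulAction.orbitRel_apply, Set.mem_ofPred_eq,
      and_iff_right_iff_imp]
    rintro ⟨σ, rfl⟩
    exact hs σ x hx
  have sum_O : ∑ y ∈ O, f y = O.card * f x := by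
    rw [← nsmul_eq_mul, ← Finset.sum_const]
    refine Finset.sum_congr rfl fun y hy => ?_
    obtain ⟨σ, rfl⟩ := coe_O ▸ Finset.mem_coe.2 hy
    exact hf σ x
  have : Finite (MulAction.orbit G x) := coe_O ▸ O.finite_toSet
  obtain ⟨n, hn⟩ := hG.card_orbit x
  have card_O : O.card = p ^ n := by
    rw [← hn, ← coe_O]
    exact (Nat.card_eq_finsetCard O).symm
  rw [sum_O]
  rcases n with _ | n
  · refine natCast_dvd_mul_of_dvd_right (hfixed x hx fun σ => ?_) _
    have := (Nat.card_eq_one_iff_unique.1 hn).1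
    exact congrArg Subtype.val (Subsingleton.elim
      (⟨σ • x, σ, rfl⟩ : MulAction.orbit G x) ⟨x, MulAction.mem_orbit_self x⟩)
  · rw [card_O, pow_succ', Nat.cast_mul, mul_assoc]
    exact dvd_mul_right _ _

theorem natCast_dvd_map_of_isPGroup (hG : IsPGroup p G) {A M N : Type*} [CommSemiring A]
    [AddCommMonoid M] [Module A M] [Semiring N] [Algebra A N] {τ : A →+* A} (b : Module.Basis X A M)
    (F : M →ₛₗ[τ] N) (hF : ∀ (σ : G) i, F (b (σ • i)) = F (b i)) {x : M}
    (hx : ∀ (σ : G) i, b.repr x (σ • i) = b.repr x i)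
    (hfixed : ∀ i, b.repr x i ≠ 0 → (∀ σ : G, σ • i = i) → (p : N) ∣ F (b i)) :
    (p : N) ∣ F x := by
  rw [← b.linearCombination_repr x, Finsupp.linearCombination_apply, Finsupp.sum, map_sum]
  refine natCast_dvd_sum_of_isPGroup hG (fun σ i hi => ?_) (fun σ i => ?_) fun i hi hfix => ?_
  · rwa [Finsupp.mem_support_iff, hx, ← Finsupp.mem_support_iff]
  · rw [F.map_smulₛₗ, F.map_smulₛₗ, hx, hF]
  · rw [F.map_smulₛₗ]
    exact natCast_dvd_smul_of_dvd (hfixed i (Finsupp.mem_support_iff.1 hi) hfix) _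

end PGroup

noncomputable section Coordinates

variable {A M N X Y : Type*} [Semiring A] [AddCommMonoid M] [Module A M] [AddCommMonoid N]
  [Module A N] (b : Module.Basis X A M) (b' : Module.Basis Y A N)

theorem repr_map_of_map_basis {e : X → Y} (he : Function.Injective e) {f : M →ₗ[A] N}
    (hf : ∀ i, f (b i) = b' (e i)) (x : M) (i : X) : b'.repr (f x) (e i) = b.repr x i := by
  classical
  have hcoord : b'.coord (e i) ∘ₗ f = b.coord i := by
    refine b.ext fun j => ?_
    rw [LinearMap.comp_apply, hf, Module.Basis.coord_apply, Module.Basis.coord_apply,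
      Module.Basis.repr_self_apply, Module.Basis.repr_self_apply]
    simp only [he.eq_iff]
  exact congrArg (fun F : M →ₗ[A] A => F x) hcoord

/-- The linear map that keeps the coordinates of index `i y`, `y ∈ Y`, and forgets the others. -/
def coordRestrict {i : Y → X} (hi : Function.Injective i) : M →ₗ[A] N :=
  b'.repr.symm ∘ₗ Finsupp.lcomapDomain i hi ∘ₗ b.repr.toLinearMap

theorem repr_coordRestrict {i : Y → X} (hi : Function.Injective i) (x : M) (y : Y) :
    b'.repr (coordRestrict b b' hi x) y = b.repr x (i y) := by
  simp [coordRestrict, Finsupp.lcomapDomain]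

theorem coordRestrict_basis {i : Y → X} (hi : Function.Injective i) (y : Y) :
    coordRestrict b b' hi (b (i y)) = b' y := by
  classical
  refine b'.repr.injective (Finsupp.ext fun z => ?_)
  rw [repr_coordRestrict, Module.Basis.repr_self_apply, Module.Basis.repr_self_apply]
  simp only [hi.eq_iff]

end Coordinates

noncomputable section StandardProducts

variable {W : Type*} [Group W] {Γ : Type*} [AddCommGroup Γ] {S : Set W} {φ : W → Γ}

theorem repr_T_mul_T_one (hS : IsCoxeter S) (hφ : IsWeightFunction S φ) (x y : W) :
    (basisT hS hφ).repr (T S φ x * T S φ y) 1 = (basisT hS hφ).repr (T S φ (x * y)) 1 := by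
  induction x using hS.induction_right generalizing y with
  | one => rw [T_one, one_mul, one_mul]
  | mul_simple s hs c hlen ih =>
    have hcs : T S φ c * T S φ s = T S φ (c * s) := T_mul (by rw [hlen, hS.wordLength_simple hs])
    rw [← hcs, mul_assoc, mul_assoc]
    rcases (hS.wordLength_simple_mul_ne s hs y).lt_or_gt with hlt | hgt
    · have hcy : c * y ≠ 1 := by
        rintro hcy
        rw [eq_inv_of_mul_eq_one_right hcy, hS.wordLength_inv, ← hS.wordLength_inv, mul_inv_rev,
          inv_inv, hS.inv_eq hs] at hlt
        lia
      have hrepr : (basisT hS hφ).repr (T S φ (c * y)) 1 = 0 := by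
        rw [← basisT_apply hS hφ, Module.Basis.repr_self, Finsupp.single_eq_of_ne hcy.symm]
      rw [T_simple_mul_of_gt hS hs hlt, mul_add, mul_smul_comm, map_add, map_smul,
        Finsupp.add_apply, Finsupp.smul_apply, ih, ih, hrepr, smul_zero, add_zero]
    · rw [T_simple_mul_of_lt hS hs hgt, ih]

theorem repr_T_mul_T_of_notMem_closure (hS : IsCoxeter S) (hφ : IsWeightFunction S φ) {I : Set W}
    (hI : I ⊆ S) {c c' w : W} (hc : c ∈ Subgroup.closure I) (hc' : c' ∈ Subgroup.closure I)
    (hw : w ∉ Subgroup.closure I) : (basisT hS hφ).repr (T S φ c * T S φ c') w = 0 := by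
  have hmem := T_mul_mem_span_closure (φ := φ) hS hI hc (Submodule.subset_span ⟨c', hc', rfl⟩)
  rw [← coe_basisT hS hφ, Module.Basis.mem_span_image, coe_basisT] at hmem
  exact Finsupp.notMem_support_iff.1 fun h => hw (hmem h)

/-- The index character `T_w ↦ e ^ φ(w)` of the Hecke algebra. -/
def indexChar (hφ : IsWeightFunction S φ) : Hecke S φ →ₐ[ℤ[Γ]] ℤ[Γ] :=
  heckeLift (fun w => expo (φ w)) (by rw [hφ.map_one, expo_zero])
    (fun w w' hw => by rw [hφ w w' hw, expo_add]) (fun s _ => by simp)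

theorem indexChar_T (hφ : IsWeightFunction S φ) (w : W) :
    indexChar hφ (T S φ w) = expo (φ w) :=
  heckeLift_T _ _ _ _ _

end StandardProducts

noncomputable section Equivariance

variable {W : Type*} [Group W] {Γ : Type*} [AddCommGroup Γ]

/-- `G` is a group of automorphisms of the Coxeter system `(W, S)` that preserve the weight
function `φ`. -/
structure WeightedAction (S : Set W) (φ : W → Γ) (G : Subgroup (MulAut W)) : Prop where
  isCoxeter : IsCoxeter S
  isWeightFunction : IsWeightFunction S φ
  image_eq : ∀ σ ∈ G, (fun w => σ w) '' S = S
  weight_map : ∀ σ ∈ G, ∀ w, φ (σ w) = φ w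

namespace WeightedAction

variable {S : Set W} {φ : W → Γ} {G : Subgroup (MulAut W)} (d : WeightedAction S φ G)
include d

theorem isCoxeter_fixed [Finite G] : IsCoxeter (fixedSimple S G) :=
  isCoxeter_fixedSimple d.isCoxeter d.image_eq

theorem isWeightFunction_fixed [Finite G] :
    IsWeightFunction (fixedSimple S G) (fixedWeight φ G) :=
  isWeightFunction_fixedWeight d.isCoxeter d.image_eq d.isWeightFunction

/-- The basis `(T_w)` of the Hecke algebra of `W`. -/
abbrev basis : Module.Basis W ℤ[Γ] (Hecke S φ) :=
  basisT d.isCoxeter d.isWeightFunction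

/-- The action of `σ ∈ G` on the Hecke algebra, `T_w ↦ T_{σ(w)}`. -/
def act (σ : G) : Hecke S φ →ₐ[ℤ[Γ]] Hecke S φ :=
  heckeLift (fun w => T S φ (σ • w)) (by rw [smul_one, T_one])
    (fun w w' hw => by
      have hlen := wordLength_smul d.isCoxeter d.image_eq σ
      rw [T_mul (by rw [← smul_mul', hlen, hlen, hlen, hw]), smul_mul'])
    (fun s hs => by
      have hσs : σ • s ∈ S := orbit_subset d.image_eq hs ⟨σ, rfl⟩
      have hφσ : φ (σ • s) = φ s := d.weight_map σ σ.2 s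
      exact hφσ ▸ T_quadratic (φ := φ) hσs)

theorem act_T (σ : G) (w : W) : d.act σ (T S φ w) = T S φ (σ • w) :=
  heckeLift_T _ _ _ _ _

theorem act_bar (σ : G) (x : Hecke S φ) : d.act σ (bar S φ x) = bar S φ (d.act σ x) := by
  have hbar := isBar_bar (φ := φ) d.isCoxeter
  have hcomp : (d.act σ).toRingHom.comp (bar S φ) = (bar S φ).comp (d.act σ).toRingHom := by
    refine hecke_ringHom_ext (fun γ => ?_) fun w => ?_
    · simp only [AlgHom.toRingHom_eq_coe, RingHom.comp_apply, hbar.1, RingHom.coe_coe,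
        AlgHom.commutes]
    · have left_inv := congrArg (d.act σ) (hbar.2 w).1
      rw [map_mul, map_one, act_T, smul_inv'] at left_inv
      simp only [AlgHom.toRingHom_eq_coe, RingHom.comp_apply, RingHom.coe_coe, act_T]
      exact left_inv_eq_right_inv left_inv (hbar.2 (σ • w)).2
  exact DFunLike.congr_fun hcomp x

/-- The `G`-invariant elements of the Hecke algebra. -/
def IsInvariant (x : Hecke S φ) : Prop :=
  ∀ σ : G, d.act σ x = x

theorem isInvariant_T (w : FixedPoints.subgroup G W) : d.IsInvariant (T S φ w) := fun σ => by
  rw [act_T, w.2 σ]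

variable {d}

theorem IsInvariant.mul {x y : Hecke S φ} (hx : d.IsInvariant x) (hy : d.IsInvariant y) :
    d.IsInvariant (x * y) := fun σ => by
  rw [map_mul, hx σ, hy σ]

theorem IsInvariant.bar {x : Hecke S φ} (hx : d.IsInvariant x) :
    d.IsInvariant (bar S φ x) := fun σ => by
  rw [act_bar, hx σ]

variable {b : Module.Basis W ℤ[Γ] (Hecke S φ)} (hb : ∀ (σ : G) w, d.act σ (b w) = b (σ • w))
include hb

theorem repr_act_smul (σ : G) (x : Hecke S φ) (w : W) :
    b.repr (d.act σ x) (σ • w) = b.repr x w :=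
  repr_map_of_map_basis b b (MulAction.injective σ) (f := (d.act σ).toLinearMap) (hb σ) x w

theorem IsInvariant.natCast_dvd_map {p : ℕ} [Fact p.Prime] (hG : IsPGroup p G) {N : Type*} [Ring N]
    [Algebra ℤ[Γ] N] {τ : ℤ[Γ] →+* ℤ[Γ]} (F : Hecke S φ →ₛₗ[τ] N)
    (hF : ∀ (σ : G) x, F (d.act σ x) = F x) {x : Hecke S φ} (hx : d.IsInvariant x)
    (hfixed : ∀ w : FixedPoints.subgroup G W, b.repr x w ≠ 0 → (p : N) ∣ F (b w)) :
    (p : N) ∣ F x := by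
  refine natCast_dvd_map_of_isPGroup hG b F (fun σ w => ?_) (fun σ w => ?_)
    fun w hw hσw => hfixed ⟨w, hσw⟩ hw
  · rw [← hb, hF]
  · rw [← d.repr_act_smul hb σ x w, hx σ]

end WeightedAction

end Equivariance

noncomputable section Projection

namespace WeightedAction

variable {W : Type*} [Group W] {Γ : Type*} [AddCommGroup Γ] {S : Set W} {φ : W → Γ}
  {G : Subgroup (MulAut W)} (d : WeightedAction S φ G)

local notation "Hᴳ" => Hecke (fixedSimple S G) (fixedWeight φ G)

local notation "Tᴳ" => T (fixedSimple S G) (fixedWeight φ G)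

theorem act_basis (σ : G) (w : W) : d.act σ (d.basis w) = d.basis (σ • w) := by
  rw [basisT_apply, basisT_apply, act_T]

theorem coordRestrict_act {N : Type*} [AddCommMonoid N] [Module ℤ[Γ] N]
    {b : Module.Basis W ℤ[Γ] (Hecke S φ)} (hb : ∀ (σ : G) w, d.act σ (b w) = b (σ • w))
    (b' : Module.Basis (FixedPoints.subgroup G W) ℤ[Γ] N) (σ : G) (x : Hecke S φ) :
    coordRestrict b b' Subtype.val_injective (d.act σ x) =
      coordRestrict b b' Subtype.val_injective x := by
  refine b'.repr.injective (Finsupp.ext fun w => ?_)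
  rw [repr_coordRestrict, repr_coordRestrict, ← repr_act_smul hb σ x w, w.2 σ]

theorem indexChar_act (σ : G) (x : Hecke S φ) :
    indexChar d.isWeightFunction (d.act σ x) = indexChar d.isWeightFunction x := by
  have hcomp : (indexChar d.isWeightFunction).toLinearMap ∘ₗ (d.act σ).toLinearMap =
      (indexChar d.isWeightFunction).toLinearMap := by
    refine d.basis.ext fun w => ?_
    simp only [LinearMap.comp_apply, basisT_apply, AlgHom.toLinearMap_apply, act_T, indexChar_T]
    exact congrArg expo (d.weight_map σ σ.2 w)
  exact DFunLike.congr_fun hcomp x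

variable [Finite G]

/-- The basis `(T_w)` of the Hecke algebra of `W ^ G`. -/
abbrev basisFixed : Module.Basis (FixedPoints.subgroup G W) ℤ[Γ] Hᴳ :=
  basisT d.isCoxeter_fixed d.isWeightFunction_fixed

/-- The projection onto the Hecke algebra of `W ^ G` that keeps the coordinates on the `T_w`,
`w ∈ W ^ G`. -/
def proj : Hecke S φ →ₗ[ℤ[Γ]] Hᴳ :=
  coordRestrict d.basis d.basisFixed Subtype.val_injective

theorem repr_proj (x : Hecke S φ) (w : FixedPoints.subgroup G W) :
    d.basisFixed.repr (d.proj x) w = d.basis.repr x w :=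
  repr_coordRestrict d.basis d.basisFixed Subtype.val_injective x w

theorem proj_T (w : FixedPoints.subgroup G W) : d.proj (T S φ w) = Tᴳ w := by
  simpa only [basisT_apply] using
    show d.proj (d.basis w) = d.basisFixed w from
      coordRestrict_basis d.basis d.basisFixed Subtype.val_injective w

theorem proj_one : d.proj 1 = 1 := by
  simpa only [Subgroup.coe_one, T_one] using d.proj_T 1

theorem proj_act (σ : G) (x : Hecke S φ) : d.proj (d.act σ x) = d.proj x :=
  d.coordRestrict_act d.act_basis d.basisFixed σ x

/-- The failure of the projection to be multiplicative, as a bilinear map. -/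
def mulDefect : Hecke S φ →ₗ[ℤ[Γ]] Hecke S φ →ₗ[ℤ[Γ]] Hᴳ :=
  (LinearMap.mul ℤ[Γ] (Hecke S φ)).compr₂ d.proj -
    (LinearMap.mul ℤ[Γ] Hᴳ).compl₁₂ d.proj d.proj

theorem mulDefect_apply (x y : Hecke S φ) :
    d.mulDefect x y = d.proj (x * y) - d.proj x * d.proj y := rfl

theorem mulDefect_one_left (x : Hecke S φ) : d.mulDefect 1 x = 0 := by
  rw [mulDefect_apply, proj_one, one_mul, one_mul, sub_self]

theorem mulDefect_act (σ : G) (x y : Hecke S φ) :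
    d.mulDefect (d.act σ x) (d.act σ y) = d.mulDefect x y := by
  simp only [mulDefect_apply, ← map_mul (d.act σ), proj_act]

theorem mulDefect_cocycle (x y z : Hecke S φ) :
    d.mulDefect (x * y) z + d.mulDefect x y * d.proj z =
      d.mulDefect x (y * z) + d.proj x * d.mulDefect y z := by
  simp only [mulDefect_apply, mul_assoc, sub_mul, mul_sub]
  abel

theorem mulDefect_T_T {w w' : FixedPoints.subgroup G W}
    (hlen : ℓ[S] (w * w' : W) = ℓ[S] (w : W) + ℓ[S] (w' : W))
    (hlenG : ℓ[fixedSimple S G] (w * w') = ℓ[fixedSimple S G] w + ℓ[fixedSimple S G] w') :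
    d.mulDefect (T S φ w) (T S φ w') = 0 := by
  rw [mulDefect_apply, T_mul hlen, ← Subgroup.coe_mul, proj_T, proj_T, proj_T, T_mul hlenG,
    sub_self]

theorem mulDefect_T_T_of_lt {x w : FixedPoints.subgroup G W} (hx : x ∈ fixedSimple S G)
    (hw : ℓ[S] (w : W) < ℓ[S] (x * w : W)) : d.mulDefect (T S φ x) (T S φ w) = 0 := by
  have hltG := (wordLength_lt_fixedSimple_mul_iff d.isCoxeter d.image_eq hx).2 hw
  have := d.isCoxeter_fixed.wordLength_simple hx
  have := d.isCoxeter_fixed.wordLength_simple_mul hx w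
  exact d.mulDefect_T_T (wordLength_mul_of_mem_fixedSimple d.isCoxeter d.image_eq hx hw) (by lia)

omit [Finite G] in
theorem eq_one_or_eq_of_repr_T_mul_T_self_ne_zero {x w : FixedPoints.subgroup G W}
    (hx : x ∈ fixedSimple S G) (hw : d.basis.repr (T S φ x * T S φ x) w ≠ 0) :
    w = 1 ∨ w = x := by
  obtain ⟨s, hs, -, hx⟩ := hx
  have hmem : (w : W) ∈ Subgroup.closure (MulAction.orbit G s) := by
    by_contra hmem
    exact hw (repr_T_mul_T_of_notMem_closure d.isCoxeter d.isWeightFunction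
      (orbit_subset d.image_eq hs) hx.1 hx.1 hmem)
  exact (eq_one_or_eq_of_mem_closure_orbit d.isCoxeter d.image_eq hs hx hmem).imp_right Subtype.ext

theorem proj_T_mul_T_self {x : FixedPoints.subgroup G W} (hx : x ∈ fixedSimple S G) :
    d.proj (T S φ x * T S φ x) = 1 + d.basis.repr (T S φ x * T S φ x) x • Tᴳ x := by
  classical
  have hx1 : x ≠ 1 := by
    rintro rfl
    simpa [wordLength_one] using wordLength_pos_of_mem_fixedSimple d.isCoxeter d.image_eq hx
  have hxx : (x : W) * x = 1 := congrArg Subtype.val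
    (mul_self_of_mem_fixedSimple d.isCoxeter d.image_eq hx)
  have repr_one : d.basis.repr (T S φ x * T S φ x) 1 = 1 := by
    rw [repr_T_mul_T_one, hxx, ← basisT_apply d.isCoxeter d.isWeightFunction,
      Module.Basis.repr_self, Finsupp.single_eq_same]
  refine d.basisFixed.repr.injective (Finsupp.ext fun w => ?_)
  rw [repr_proj, map_add, map_smul, ← T_one (S := fixedSimple S G) (φ := fixedWeight φ G),
    ← basisT_apply d.isCoxeter_fixed d.isWeightFunction_fixed,
    ← basisT_apply d.isCoxeter_fixed d.isWeightFunction_fixed, Finsupp.add_apply,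
    Finsupp.smul_apply, Module.Basis.repr_self, Module.Basis.repr_self]
  by_cases hw : w = 1 ∨ w = x
  · rcases hw with rfl | rfl
    · simp [repr_one, hx1]
    · simp [hx1.symm]
  · have repr_w := mt (d.eq_one_or_eq_of_repr_T_mul_T_self_ne_zero hx) hw
    rw [not_or] at hw
    rw [not_not.1 repr_w, Finsupp.single_eq_of_ne hw.1, Finsupp.single_eq_of_ne hw.2, smul_zero,
      add_zero]

/-- The failure of the projection to commute with the bar involutions, as a semilinear map. -/
def barDefect : Hecke S φ →ₛₗ[(barA : ℤ[Γ] →+* ℤ[Γ])] Hᴳ where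
  toFun x := d.proj (bar S φ x) - bar (fixedSimple S G) (fixedWeight φ G) (d.proj x)
  map_add' x y := by simp only [map_add, add_sub_add_comm]
  map_smul' a x := by
    rw [bar_smul d.isCoxeter, map_smul, map_smul, bar_smul d.isCoxeter_fixed, smul_sub]

theorem barDefect_apply (x : Hecke S φ) :
    d.barDefect x = d.proj (bar S φ x) - bar (fixedSimple S G) (fixedWeight φ G) (d.proj x) := rfl

theorem barDefect_act (σ : G) (x : Hecke S φ) : d.barDefect (d.act σ x) = d.barDefect x := by
  rw [barDefect_apply, ← act_bar, proj_act, proj_act, barDefect_apply]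

variable {d} {p : ℕ} [Fact p.Prime] (hG : IsPGroup p G)
include hG

theorem IsInvariant.natCast_dvd_indexChar_sub {x : Hecke S φ} (hx : d.IsInvariant x) :
    (p : ℤ[Γ]) ∣ indexChar d.isWeightFunction x -
      indexChar d.isWeightFunction_fixed (d.proj x) := by
  refine hx.natCast_dvd_map d.act_basis hG ((indexChar d.isWeightFunction).toLinearMap -
    (indexChar d.isWeightFunction_fixed).toLinearMap ∘ₗ d.proj) (fun σ y => ?_) fun w _ => ?_
  · simp only [LinearMap.sub_apply, LinearMap.comp_apply, AlgHom.toLinearMap_apply, indexChar_act,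
      proj_act]
  · simp only [LinearMap.sub_apply, LinearMap.comp_apply, AlgHom.toLinearMap_apply, basisT_apply,
      proj_T, indexChar_T, fixedWeight, sub_self, dvd_zero]

theorem IsInvariant.natCast_dvd_mulDefect_left {x y : Hecke S φ} (hx : d.IsInvariant x)
    (hy : d.IsInvariant y) (hfixed : ∀ w : FixedPoints.subgroup G W, d.basis.repr x w ≠ 0 →
      (p : Hᴳ) ∣ d.mulDefect (T S φ w) y) :
    (p : Hᴳ) ∣ d.mulDefect x y := by
  refine hx.natCast_dvd_map d.act_basis hG (d.mulDefect.flip y) (fun σ x => ?_) fun w hw => ?_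
  · rw [LinearMap.flip_apply, LinearMap.flip_apply, ← d.mulDefect_act σ x y, hy σ]
  · rw [LinearMap.flip_apply, basisT_apply]
    exact hfixed w hw

theorem IsInvariant.natCast_dvd_mulDefect_right {x y : Hecke S φ} (hx : d.IsInvariant x)
    (hy : d.IsInvariant y) (hfixed : ∀ w : FixedPoints.subgroup G W,
      (p : Hᴳ) ∣ d.mulDefect x (T S φ w)) :
    (p : Hᴳ) ∣ d.mulDefect x y := by
  refine hy.natCast_dvd_map d.act_basis hG (d.mulDefect x) (fun σ y => ?_) fun w _ => ?_
  · rw [← d.mulDefect_act σ x y, hx σ]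
  · rw [basisT_apply]
    exact hfixed w

theorem natCast_dvd_mulDefect_T_T_self {x : FixedPoints.subgroup G W}
    (hx : x ∈ fixedSimple S G) :
    (p : Hᴳ) ∣ d.mulDefect (T S φ x) (T S φ x) := by
  set a := d.basis.repr (T S φ x * T S φ x) x
  have hproj : d.proj (T S φ x * T S φ x) = 1 + a • Tᴳ x := d.proj_T_mul_T_self hx
  have hindex := ((d.isInvariant_T x).mul (d.isInvariant_T x)).natCast_dvd_indexChar_sub hG
  have hdvd : (p : ℤ[Γ]) ∣ a - xi (fixedWeight φ G) x := by
    rw [hproj, map_add, map_one, map_smul, map_mul, indexChar_T, indexChar_T] at hindex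
    convert hindex.neg_right.mul_right (expo (-φ x)) using 1
    simp only [xi, fixedWeight, smul_eq_mul]
    linear_combination (expo (φ (x : W)) - a) * expo_mul_expo_neg (φ (x : W))
  rw [mulDefect_apply, hproj, proj_T, T_mul_self hx, add_sub_add_left_eq_sub, ← sub_smul]
  obtain ⟨c, hc⟩ := hdvd
  exact ⟨c • Tᴳ x, by rw [hc, mul_smul, Nat.cast_smul_eq_nsmul, nsmul_eq_mul]⟩

theorem natCast_dvd_mulDefect_T_T {x : FixedPoints.subgroup G W} (hx : x ∈ fixedSimple S G)
    (v : FixedPoints.subgroup G W) :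
    (p : Hᴳ) ∣ d.mulDefect (T S φ x) (T S φ v) := by
  by_cases hv : ℓ[S] (v : W) < ℓ[S] (x * v : W)
  · exact d.mulDefect_T_T_of_lt hx hv ▸ dvd_zero _
  obtain ⟨u, rfl⟩ : ∃ u, v = x * u := ⟨x⁻¹ * v, by group⟩
  have hu : ℓ[S] (u : W) < ℓ[S] (x * u : W) := by
    have hlt_iff := @wordLength_lt_fixedSimple_mul_iff _ _ _ _ d.isCoxeter d.image_eq _ x hx
    have hvG := (hlt_iff (w := x * u)).not.2 hv
    rw [d.isCoxeter_fixed.simple_mul_cancel_left hx] at hvG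
    exact hlt_iff.1 ((not_lt.1 hvG).lt_of_ne
      (d.isCoxeter_fixed.wordLength_simple_mul_ne x hx u).symm)
  have hTxu : T S φ x * T S φ u = T S φ (x * u) :=
    T_mul (wordLength_mul_of_mem_fixedSimple d.isCoxeter d.image_eq hx hu)
  have hcocycle := d.mulDefect_cocycle (T S φ x) (T S φ x) (T S φ u)
  rw [d.mulDefect_T_T_of_lt hx hu, mul_zero, add_zero, hTxu] at hcocycle
  rw [Subgroup.coe_mul, ← hcocycle]
  refine dvd_add ?_ (dvd_mul_of_dvd_left (natCast_dvd_mulDefect_T_T_self hG hx) _)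
  refine ((d.isInvariant_T x).mul (d.isInvariant_T x)).natCast_dvd_mulDefect_left hG
    (d.isInvariant_T u) fun w hw => ?_
  rcases d.eq_one_or_eq_of_repr_T_mul_T_self_ne_zero hx hw with rfl | rfl
  · rw [Subgroup.coe_one, T_one, mulDefect_one_left]
    exact dvd_zero _
  · exact d.mulDefect_T_T_of_lt hx hu ▸ dvd_zero _

theorem IsInvariant.natCast_dvd_mulDefect_T {y : Hecke S φ} (hy : d.IsInvariant y)
    (x : FixedPoints.subgroup G W) :
    (p : Hᴳ) ∣ d.mulDefect (T S φ x) y := by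
  induction x using d.isCoxeter_fixed.induction_left with
  | one =>
    rw [Subgroup.coe_one, T_one, mulDefect_one_left]
    exact dvd_zero _
  | simple_mul x hx c hlen ih =>
    have hlenG : ℓ[fixedSimple S G] (x * c) = ℓ[fixedSimple S G] x + ℓ[fixedSimple S G] c := by
      rw [hlen, d.isCoxeter_fixed.wordLength_simple hx, add_comm]
    have hlenS := wordLength_mul_of_wordLength_fixedSimple_mul d.isCoxeter d.image_eq hlenG
    have hcocycle := d.mulDefect_cocycle (T S φ x) (T S φ c) y
    rw [d.mulDefect_T_T hlenS hlenG, zero_mul, add_zero, T_mul hlenS] at hcocycle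
    rw [Subgroup.coe_mul, hcocycle]
    exact dvd_add ((d.isInvariant_T x).natCast_dvd_mulDefect_right hG
      ((d.isInvariant_T c).mul hy) (natCast_dvd_mulDefect_T_T hG hx))
      (natCast_dvd_mul_of_dvd_right ih _)

theorem IsInvariant.natCast_dvd_mulDefect {x y : Hecke S φ} (hx : d.IsInvariant x)
    (hy : d.IsInvariant y) :
    (p : Hᴳ) ∣ d.mulDefect x y :=
  hx.natCast_dvd_mulDefect_left hG hy fun w _ => hy.natCast_dvd_mulDefect_T hG w

theorem natCast_dvd_barDefect_T (w : FixedPoints.subgroup G W) :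
    (p : Hᴳ) ∣ d.barDefect (T S φ w) := by
  have hdefect : (p : Hᴳ) ∣ 1 - d.proj (bar S φ (T S φ w)) * Tᴳ w⁻¹ := by
    have hdvd := (d.isInvariant_T w).bar.natCast_dvd_mulDefect hG (d.isInvariant_T w⁻¹)
    rwa [mulDefect_apply, Subgroup.coe_inv, ((isBar_bar d.isCoxeter).2 (w : W)).1, proj_one,
      ← Subgroup.coe_inv, proj_T] at hdvd
  have mul_bar := ((isBar_bar (φ := fixedWeight φ G) d.isCoxeter_fixed).2 w).2
  have hdvd := dvd_mul_of_dvd_left hdefect (bar (fixedSimple S G) (fixedWeight φ G) (Tᴳ w))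
  rw [sub_mul, one_mul, mul_assoc, mul_bar, mul_one] at hdvd
  rwa [barDefect_apply, proj_T, dvd_sub_comm]

theorem IsInvariant.natCast_dvd_barDefect {x : Hecke S φ} (hx : d.IsInvariant x) :
    (p : Hᴳ) ∣ d.barDefect x :=
  hx.natCast_dvd_map d.act_basis hG d.barDefect d.barDefect_act fun w _ => by
    rw [basisT_apply]
    exact natCast_dvd_barDefect_T hG w

end WeightedAction

end Projection

noncomputable section KazhdanLusztigModP

namespace WeightedAction

variable {W : Type*} [Group W] {Γ : Type*} [AddCommGroup Γ] [LinearOrder Γ] {S : Set W}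
  {φ : W → Γ} {G : Subgroup (MulAut W)} (d : WeightedAction S φ G)

local notation "Hᴳ" => Hecke (fixedSimple S G) (fixedWeight φ G)

local notation "Cᴳ" => C (fixedSimple S G) (fixedWeight φ G)

theorem act_mem_negPart (σ : G) {x : Hecke S φ} (hx : x ∈ negPart S φ) :
    d.act σ x ∈ negPart S φ := by
  induction hx using AddSubgroup.closure_induction with
  | mem x hx =>
    obtain ⟨γ, hγ, w, rfl⟩ := hx
    exact AddSubgroup.subset_closure ⟨γ, hγ, σ • w, by rw [map_smul, act_T]⟩
  | zero => rw [map_zero]; exact zero_mem _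
  | add x y _ _ hx hy => rw [map_add]; exact add_mem hx hy
  | neg x _ hx => rw [map_neg]; exact neg_mem hx

theorem proj_mem_negPart [Finite G] {x : Hecke S φ} (hx : x ∈ negPart S φ) :
    d.proj x ∈ negPart (fixedSimple S G) (fixedWeight φ G) := by
  rw [mem_negPart_iff d.isCoxeter_fixed d.isWeightFunction_fixed]
  intro w γ hγ
  rw [repr_proj]
  exact (mem_negPart_iff d.isCoxeter d.isWeightFunction).1 hx w γ hγ

variable [IsOrderedAddMonoid Γ]

theorem act_C (σ : G) (w : W) : d.act σ (C S φ w) = C S φ (σ • w) := by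
  obtain ⟨bar_C, sub_mem⟩ := isKLElement_C d.isCoxeter d.isWeightFunction w
  refine IsKLElement.eq d.isCoxeter d.isWeightFunction ⟨?_, ?_⟩
    (isKLElement_C d.isCoxeter d.isWeightFunction (σ • w))
  · rw [← act_bar, bar_C]
  · rw [← d.act_T, ← map_sub]
    exact d.act_mem_negPart σ sub_mem

/-- The basis `(C_w)` of the Hecke algebra of `W`. -/
abbrev klBasis : Module.Basis W ℤ[Γ] (Hecke S φ) :=
  basisC d.isCoxeter d.isWeightFunction

theorem act_klBasis (σ : G) (w : W) : d.act σ (d.klBasis w) = d.klBasis (σ • w) := by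
  rw [basisC_apply, basisC_apply, act_C]

theorem isInvariant_C (w : FixedPoints.subgroup G W) : d.IsInvariant (C S φ w) := fun σ => by
  rw [act_C, w.2 σ]

variable [Finite G]

/-- The basis `(C_w)` of the Hecke algebra of `W ^ G`. -/
abbrev klBasisFixed : Module.Basis (FixedPoints.subgroup G W) ℤ[Γ] Hᴳ :=
  basisC d.isCoxeter_fixed d.isWeightFunction_fixed

variable {p : ℕ} [Fact p.Prime] (hG : IsPGroup p G)
include d hG

theorem natCast_dvd_proj_C_sub (z : FixedPoints.subgroup G W) :
    (p : Hᴳ) ∣ d.proj (C S φ z) - Cᴳ z := by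
  obtain ⟨bar_C, sub_mem_negPart⟩ := isKLElement_C d.isCoxeter d.isWeightFunction (z : W)
  obtain ⟨bar_C_fixed, sub_mem_negPart_fixed⟩ :=
    isKLElement_C d.isCoxeter_fixed d.isWeightFunction_fixed z
  refine natCast_dvd_of_dvd_bar_sub d.isCoxeter_fixed d.isWeightFunction_fixed ?_ ?_
  · have proj_sub_mem := d.proj_mem_negPart sub_mem_negPart
    rw [map_sub, d.proj_T] at proj_sub_mem
    simpa only [sub_sub_sub_cancel_right] using sub_mem proj_sub_mem sub_mem_negPart_fixed
  · have hdvd := (d.isInvariant_C z).natCast_dvd_barDefect hG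
    rw [barDefect_apply, bar_C] at hdvd
    rwa [map_sub (bar _ _), bar_C_fixed, sub_sub_sub_cancel_right, dvd_sub_comm]

theorem natCast_dvd_proj_C_mul_C_sub (x y : FixedPoints.subgroup G W) :
    (p : Hᴳ) ∣ d.proj (C S φ x * C S φ y) - Cᴳ x * Cᴳ y := by
  have hsplit : d.proj (C S φ x * C S φ y) - Cᴳ x * Cᴳ y =
      d.mulDefect (C S φ x) (C S φ y) + (d.proj (C S φ x) - Cᴳ x) * d.proj (C S φ y) +
        Cᴳ x * (d.proj (C S φ y) - Cᴳ y) := by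
    simp only [mulDefect_apply, sub_mul, mul_sub]
    abel
  rw [hsplit]
  exact dvd_add (dvd_add ((d.isInvariant_C x).natCast_dvd_mulDefect hG (d.isInvariant_C y))
    (dvd_mul_of_dvd_left (d.natCast_dvd_proj_C_sub hG x) _))
    (natCast_dvd_mul_of_dvd_right (d.natCast_dvd_proj_C_sub hG y) _)

variable {d} in
theorem IsInvariant.natCast_dvd_proj_sub_coordRestrict_klBasis {x : Hecke S φ}
    (hx : d.IsInvariant x) :
    (p : Hᴳ) ∣ d.proj x - coordRestrict d.klBasis d.klBasisFixed Subtype.val_injective x := by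
  refine hx.natCast_dvd_map d.act_klBasis hG
    (d.proj - coordRestrict d.klBasis d.klBasisFixed Subtype.val_injective)
    (fun σ y => ?_) fun w _ => ?_
  · rw [LinearMap.sub_apply, LinearMap.sub_apply, proj_act,
      d.coordRestrict_act d.act_klBasis d.klBasisFixed]
  · rw [LinearMap.sub_apply, coordRestrict_basis d.klBasis, basisC_apply, basisC_apply]
    exact d.natCast_dvd_proj_C_sub hG w

theorem natCast_dvd_structureConst_sub (x y z : FixedPoints.subgroup G W) :
    (p : ℤ[Γ]) ∣ structureConst S φ (x : W) y z -
      structureConst (fixedSimple S G) (fixedWeight φ G) x y z := by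
  have hdvd := dvd_sub (d.natCast_dvd_proj_C_mul_C_sub hG x y)
    (((d.isInvariant_C x).mul (d.isInvariant_C y)).natCast_dvd_proj_sub_coordRestrict_klBasis hG)
  rw [sub_sub_sub_cancel_left, natCast_dvd_iff_forall_repr d.klBasisFixed] at hdvd
  simpa only [map_sub, Finsupp.sub_apply, repr_coordRestrict,
    structureConst_eq d.isCoxeter d.isWeightFunction,
    structureConst_eq d.isCoxeter_fixed d.isWeightFunction_fixed] using hdvd z

theorem natCast_dvd_tau_sub (z : FixedPoints.subgroup G W) :
    (p : ℤ[Γ]) ∣ tau S φ (C S φ z) - tau (fixedSimple S G) (fixedWeight φ G) (Cᴳ z) := by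
  have hdvd := (natCast_dvd_iff_forall_repr d.basisFixed).1 (d.natCast_dvd_proj_C_sub hG z) 1
  rwa [map_sub, Finsupp.sub_apply, repr_proj,
    ← tau_apply d.isCoxeter_fixed d.isWeightFunction_fixed, Subgroup.coe_one,
    ← tau_apply d.isCoxeter d.isWeightFunction] at hdvd

end WeightedAction

end KazhdanLusztigModP

end KL

theorem mainTheorem4_general {B W Γ : Type*} [Group W] {M : CoxeterMatrix B}
    (cs : CoxeterSystem M W) [AddCommGroup Γ] [LinearOrder Γ] [IsOrderedAddMonoid Γ]
    (S : Set W) (hS : S = Set.range cs.simple)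
    (φ : W → Γ) (hφ : KL.IsWeightFunction S φ)
    (p : ℕ) (hp : p.Prime) (G : Subgroup (MulAut W)) [Finite G] (hG : IsPGroup p G)
    (hGS : ∀ σ ∈ G, (fun w => σ w) '' S = S) (hGφ : ∀ σ ∈ G, ∀ w : W, φ (σ w) = φ w) :
    KL.WellDefined S φ ∧ KL.WellDefined (KL.fixedSimple S G) (KL.fixedWeight φ G) ∧
      (∀ x y z : FixedPoints.subgroup G W,
        KL.structureConst S φ (x : W) (y : W) (z : W) -
            KL.structureConst (KL.fixedSimple S G) (KL.fixedWeight φ G) x y z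
          ∈ Ideal.span {(p : AddMonoidAlgebra ℤ Γ)}) ∧
      ∀ z : FixedPoints.subgroup G W,
        KL.tau S φ (KL.C S φ (z : W)) -
            KL.tau (KL.fixedSimple S G) (KL.fixedWeight φ G)
              (KL.C (KL.fixedSimple S G) (KL.fixedWeight φ G) z)
          ∈ Ideal.span {(p : AddMonoidAlgebra ℤ Γ)} := by
  have := Fact.mk hp
  have hCox : KL.IsCoxeter S := hS ▸ KL.isCoxeter_range_simple cs
  have d : KL.WeightedAction S φ G := ⟨hCox, hφ, hGS, hGφ⟩
  exact ⟨KL.wellDefined hCox hφ, KL.wellDefined d.isCoxeter_fixed d.isWeightFunction_fixed,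
    fun x y z => Ideal.mem_span_singleton.2 (d.natCast_dvd_structureConst_sub hG x y z),
    fun z => Ideal.mem_span_singleton.2 (d.natCast_dvd_tau_sub hG z)⟩

theorem mainTheorem4 {B W Γ : Type*} [Finite B] [Group W] {M : CoxeterMatrix B}
    (cs : CoxeterSystem M W) [AddCommGroup Γ] [LinearOrder Γ] [IsOrderedAddMonoid Γ]
    (S : Set W) (hS : S = Set.range cs.simple)
    (φ : W → Γ) (hφ : KL.IsWeightFunction S φ)
    (p : ℕ) (hp : p.Prime) (G : Subgroup (MulAut W)) [Finite G] (hG : IsPGroup p G)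
    (hGS : ∀ σ ∈ G, (fun w => σ w) '' S = S) (hGφ : ∀ σ ∈ G, ∀ w : W, φ (σ w) = φ w) :
    KL.WellDefined S φ ∧ KL.WellDefined (KL.fixedSimple S G) (KL.fixedWeight φ G) ∧
      (∀ x y z : FixedPoints.subgroup G W,
        KL.structureConst S φ (x : W) (y : W) (z : W) -
            KL.structureConst (KL.fixedSimple S G) (KL.fixedWeight φ G) x y z
          ∈ Ideal.span {(p : AddMonoidAlgebra ℤ Γ)}) ∧
      ∀ z : FixedPoints.subgroup G W,
        KL.tau S φ (KL.C S φ (z : W)) -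
            KL.tau (KL.fixedSimple S G) (KL.fixedWeight φ G)
              (KL.C (KL.fixedSimple S G) (KL.fixedWeight φ G) z)
          ∈ Ideal.span {(p : AddMonoidAlgebra ℤ Γ)} :=
  mainTheorem4_general cs S hS φ hφ p hp G hG hGS hGφ
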